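/- All spaces are real. For a normed space $V$, a seminorm $S:V\to[0,\infty)$ is $1$-Lipschitz iff $S(x)\le\|x\|$ for all $x$. For $\varepsilon\ge 0$, a linear map $f:V\to W$ of normed spaces is an $\varepsilon$-isometry if $(1-\varepsilon)\|x\|\le\|f(x)\|\le(1+\varepsilon)\|x\|$ for all $x\in V$; if $S_V,S_W$ are $1$-Lipschitz seminorms on $V,W$, then $f:(S_V,V)\to(S_W,W)$ is an $\varepsilon$-morphism if it is an $\varepsilon$-isometry and $|S_V(x)-S_W(f(x))|\le\varepsilon\, S_V(x)$ for all $x\in V$ (so a $0$-morphism is a linear isometric embedding preserving the seminorms). A separable Banach space $\mathbb{G}$ is Gurarij if for all finite-dimensional Banach spaces $E\subseteq F$, every $\varepsilon>0$ and every linear isometric embedding $\phi:E\to\mathbb{G}$ there is a linear $\varepsilon$-isometry $\bar\phi:F\to\mathbb{G}$ extending $\phi$. Theorem. A Gurarij space exists, and on every Gurarij space $\mathbb{G}$ there is a $1$-Lipschitz seminorm $\mathbb{S}:\mathbb{G}\to[0,\infty)$ with the following properties. (1) (Homogeneity) For all finite-dimensional Banach spaces $E\subseteq F$ with $1$-Lipschitz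 seminorms $S_E$ on $E$ and $S_F$ on $F$ such that $S_F$ extends $S_E$, for every $\varepsilon>0$ and every $0$-morphism $\phi:(S_E,E)\to(\mathbb{S},\mathbb{G})$, there is an $\varepsilon$-morphism $\bar\phi:(S_F,F)\to(\mathbb{S},\mathbb{G})$ that extends $\phi$. (2) (Universality) The kernel $\mathbb{H}=\{x\in\mathbb{G}:\mathbb{S}(x)=0\}$ is a closed linear subspace such that for every separable Banach space $X$ and every closed subspace $Y\subseteq X$ there is a linear isometric embedding $\phi:X\to\mathbb{G}$ with $\operatorname{dist}(x,Y)=\operatorname{dist}(\phi(x),\mathbb{H})$ for all $x\in X$. -/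

import Mathlib

universe u v w

namespace GurarijSeminorm

/-- A linear map `f` is an `ε`-isometry:
`(1 - ε) * ‖x‖ ≤ ‖f x‖ ≤ (1 + ε) * ‖x‖` for every `x`. -/
def IsEpsIsometry {V : Type u} {W : Type v} [NormedAddCommGroup V] [NormedSpace ℝ V]
    [NormedAddCommGroup W] [NormedSpace ℝ W] (ε : ℝ) (f : V →ₗ[ℝ] W) : Prop :=
  ∀ x : V, (1 - ε) * ‖x‖ ≤ ‖f x‖ ∧ ‖f x‖ ≤ (1 + ε) * ‖x‖

/-- A linear map `f : (S, V) → (T, W)` is an `ε`-morphism if it is an `ε`-isometry for the norms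
and distorts the seminorms by at most the factor `ε`. For `ε = 0` this says that `f` preserves
both the norm and the seminorm. -/
def IsEpsMorphism {V : Type u} {W : Type v} [NormedAddCommGroup V] [NormedSpace ℝ V]
    [NormedAddCommGroup W] [NormedSpace ℝ W] (ε : ℝ) (S : Seminorm ℝ V) (T : Seminorm ℝ W)
    (f : V →ₗ[ℝ] W) : Prop :=
  IsEpsIsometry ε f ∧ ∀ x : V, |S x - T (f x)| ≤ ε * S x

/-- A real normed space is Gurarij if it is a separable Banach space and, for all finite
dimensional Banach spaces `E ⊆ F` and every `ε > 0`, every linear isometric embedding of `E`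
extends to an `ε`-isometry on `F`.
(Every finite dimensional real normed space is linearly isometric to one living in `Type`, so
that universe is large enough for `F`.) -/
structure IsGurarij (G : Type u) [NormedAddCommGroup G] [NormedSpace ℝ G] : Prop where
  complete : CompleteSpace G
  separable : TopologicalSpace.SeparableSpace G
  extension : ∀ (F : Type) [NormedAddCommGroup F] [NormedSpace ℝ F] [FiniteDimensional ℝ F]
    (E : Submodule ℝ F) (φ : E →ₗᵢ[ℝ] G) (ε : ℝ), 0 < ε →
      ∃ ψ : F →ₗ[ℝ] G, (∀ x : E, ψ (x : F) = φ x) ∧ IsEpsIsometry ε ψ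

/-- The homogeneity property of a pair `(S, G)`: for all finite dimensional Banach spaces `E ⊆ F`
with `1`-Lipschitz seminorms `SE`, `SF` such that `SF` extends `SE`, and every `ε > 0`, every
`0`-morphism `(SE, E) → (S, G)` extends to an `ε`-morphism `(SF, F) → (S, G)`. -/
def IsHomogeneous {G : Type u} [NormedAddCommGroup G] [NormedSpace ℝ G]
    (S : Seminorm ℝ G) : Prop :=
  ∀ (F : Type w) [NormedAddCommGroup F] [NormedSpace ℝ F] [FiniteDimensional ℝ F]
    (E : Submodule ℝ F) (SE : Seminorm ℝ E) (SF : Seminorm ℝ F),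
    LipschitzWith 1 SE → LipschitzWith 1 SF → (∀ x : E, SF (x : F) = SE x) →
    ∀ ε : ℝ, 0 < ε → ∀ φ : E →ₗ[ℝ] G, IsEpsMorphism 0 SE S φ →
      ∃ ψ : F →ₗ[ℝ] G, (∀ x : E, ψ (x : F) = φ x) ∧ IsEpsMorphism ε SF S ψ

/-- The kernel `{x | S x = 0}` of a seminorm, a linear subspace. -/
def kernel {G : Type u} [NormedAddCommGroup G] [NormedSpace ℝ G] (S : Seminorm ℝ G) :
    Submodule ℝ G where
  carrier := {x | S x = 0}
  zero_mem' := map_zero S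
  add_mem' := by
    intro a b ha hb
    have ha' : S a = 0 := ha
    have hb' : S b = 0 := hb
    have h := map_add_le_add S a b
    rw [ha', hb', add_zero] at h
    exact le_antisymm h (apply_nonneg S _)
  smul_mem' := by
    intro c x hx
    have hx' : S x = 0 := hx
    change S (c • x) = 0
    rw [map_smul_eq_mul, hx', mul_zero]

/-- A linear subspace `H` of `G` is a universal closed subspace: it is closed, and for every
closed subspace `Y` of a separable Banach space `X` there is a linear isometric embedding
`φ : X → G` with `dist(x, Y) = dist(φ x, H)` for every `x`. -/
def IsUniversalClosedSubspace {G : Type u} [NormedAddCommGroup G] [NormedSpace ℝ G]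
    (H : Submodule ℝ G) : Prop :=
  IsClosed (H : Set G) ∧
    ∀ (X : Type v) [NormedAddCommGroup X] [NormedSpace ℝ X] [CompleteSpace X]
      [TopologicalSpace.SeparableSpace X] (Y : Submodule ℝ X), IsClosed (Y : Set X) →
      ∃ φ : X →ₗᵢ[ℝ] G, ∀ x : X,
        Metric.infDist x (Y : Set X) = Metric.infDist (φ x) (H : Set G)

end GurarijSeminorm

namespace GurarijSeminorm

/-! ### Seminorms -/

/-! Everything follows from one property, `Corrects`: a map from a finite-dimensional space that
realizes a norm `p` and a seminorm `q` up to a defect `r` can be moved by little more than `r` so as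
to realize both almost exactly. On a complete space, iterating this with summable errors makes the
realization exact (`Corrects.exists_exact`).

A seminorm with this property is found by Baire category. The `1`-Lipschitz seminorms on `X` form a
compact Hausdorff space under pointwise convergence. Being able to correct one given map is an open
condition, and it is dense whenever `X` has room for the amalgam of the seminorm with `q`
(`exists_solved_near`). Separability reduces all maps to countably many, so a generic seminorm
corrects them all (`exists_seminorm_solving`). In a Gurarij space the extension property provides
the room. In the finitely supported `ℓ¹` space unused coordinates provide it; completing that space
in a generic seminorm gives a space in which norms alone can be corrected, and such a space is
Gurarij.

Homogeneity: extend `φ` by a retraction onto `E`, correct the result exactly, then repair the small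
discrepancy on `E`. Universality: embed the span of a dense sequence one vector at a time, for the
seminorm `dist(·, Y)`. -/

theorem exists_seminorm_le_mul_norm {m : ℕ} (q : Seminorm ℝ (Fin m → ℝ)) :
    ∃ C : ℝ, 0 < C ∧ ∀ x, q x ≤ C * ‖x‖ := by
  refine ⟨∑ i, q (Pi.single i 1) + 1, by positivity, fun x => ?_⟩
  have h1 : q x ≤ ∑ i, ‖x i‖ * q (Pi.single i 1) := by
    conv_lhs => rw [pi_eq_sum_univ' x]
    refine (Finset.le_sum_of_subadditive q (map_zero q).le (map_add_le_add q) _ _).trans ?_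
    refine Finset.sum_le_sum fun i _ => ?_
    rw [map_smul_eq_mul]
  have h2 : ∑ i, ‖x i‖ * q (Pi.single i 1) ≤ (∑ i, q (Pi.single i 1)) * ‖x‖ := by
    rw [Finset.sum_mul]
    refine Finset.sum_le_sum fun i _ => ?_
    rw [mul_comm]
    exact mul_le_mul_of_nonneg_left (norm_le_pi_norm x i) (apply_nonneg q _)
  nlinarith [norm_nonneg x]

theorem abs_seminorm_sub_le {V : Type*} [AddCommGroup V] [Module ℝ V] (q : Seminorm ℝ V)
    (x y : V) : |q x - q y| ≤ q (x - y) :=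
  abs_sub_map_le_sub q x y

theorem seminorm_continuous_of_le_norm {X : Type*} [SeminormedAddCommGroup X] [NormedSpace ℝ X]
    (q : Seminorm ℝ X) {C : ℝ} (hC : ∀ x, q x ≤ C * ‖x‖) : Continuous q :=
  Seminorm.continuous_of_le (q := C.toNNReal • normSeminorm ℝ X)
    ((continuous_norm.const_smul C.toNNReal)) fun x => by
      refine (hC x).trans ?_
      change C * ‖x‖ ≤ C.toNNReal * ‖x‖
      exact mul_le_mul_of_nonneg_right (Real.le_coe_toNNReal C) (norm_nonneg _)

theorem seminorm_continuous_pi {m : ℕ} (q : Seminorm ℝ (Fin m → ℝ)) : Continuous q := by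
  obtain ⟨C, -, hC⟩ := exists_seminorm_le_mul_norm q
  exact seminorm_continuous_of_le_norm q hC

theorem lipschitzWith_one_of_le {X : Type*} [SeminormedAddCommGroup X] [NormedSpace ℝ X]
    (q : Seminorm ℝ X) (h : ∀ x, q x ≤ ‖x‖) : LipschitzWith 1 q :=
  LipschitzWith.of_dist_le_mul fun x y => by
    rw [Real.dist_eq, dist_eq_norm, NNReal.coe_one, one_mul]
    exact (abs_seminorm_sub_le q x y).trans (h _)

theorem le_norm_of_lipschitzWith_one {X : Type*} [SeminormedAddCommGroup X] [NormedSpace ℝ X]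
    (q : Seminorm ℝ X) (h : LipschitzWith 1 q) (x : X) : q x ≤ ‖x‖ := by
  have := h.dist_le_mul x 0
  rw [Real.dist_eq, map_zero, sub_zero, dist_zero_right, NNReal.coe_one, one_mul] at this
  exact (le_abs_self _).trans this

/-- The infimal convolution of a seminorm `p` on `X` with the image under `T` of a seminorm `r`
on `D`. -/
noncomputable def infConv {X D : Type*} [AddCommGroup X] [Module ℝ X] [AddCommGroup D]
    [Module ℝ D] (p : Seminorm ℝ X) (r : Seminorm ℝ D) (T : D →ₗ[ℝ] X) : Seminorm ℝ X :=
  have bdd : ∀ x, BddBelow (Set.range fun d => p (x - T d) + r d) := fun x =>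
    ⟨0, by rintro _ ⟨d, rfl⟩; exact add_nonneg (apply_nonneg p _) (apply_nonneg r _)⟩
  Seminorm.ofSMulLE (fun x => ⨅ d, (p (x - T d) + r d))
    (le_antisymm ((ciInf_le (bdd 0) 0).trans (by simp))
      (Real.iInf_nonneg fun d => add_nonneg (apply_nonneg p _) (apply_nonneg r _)))
    (fun x y => by
      refine le_ciInf_add_ciInf fun d d' => ?_
      refine (ciInf_le (bdd _) (d + d')).trans ?_
      have h1 := map_add_le_add p (x - T d) (y - T d')
      have h2 := map_add_le_add r d d'
      rw [show x + y - T (d + d') = x - T d + (y - T d') by rw [map_add]; abel]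
      linarith)
    (fun c x => by
      rw [Real.mul_iInf_of_nonneg (norm_nonneg c)]
      refine le_ciInf fun d => ?_
      refine (ciInf_le (bdd _) (c • d)).trans (le_of_eq ?_)
      rw [map_smul, ← smul_sub, map_smul_eq_mul, map_smul_eq_mul, mul_add])

section infConv

variable {X D : Type*} [AddCommGroup X] [Module ℝ X] [AddCommGroup D]
    [Module ℝ D] (p : Seminorm ℝ X) (r : Seminorm ℝ D) (T : D →ₗ[ℝ] X)

theorem infConv_le (x : X) (d : D) : infConv p r T x ≤ p (x - T d) + r d :=
  ciInf_le ⟨0, by rintro _ ⟨d, rfl⟩; exact add_nonneg (apply_nonneg p _) (apply_nonneg r _)⟩ d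

theorem le_infConv {x : X} {c : ℝ} (h : ∀ d, c ≤ p (x - T d) + r d) : c ≤ infConv p r T x :=
  le_ciInf h

theorem infConv_le_left (x : X) : infConv p r T x ≤ p x := by
  simpa using infConv_le p r T x 0

theorem infConv_apply_le (d : D) : infConv p r T (T d) ≤ r d := by
  simpa using infConv_le p r T (T d) d

end infConv

/-- The amalgam of `p` on `X` and `q` on `F` along `φ : F → X`, where `φ w` and `w` are at
distance at most `s w`. -/
noncomputable def amalgam {X F : Type*} [AddCommGroup X] [Module ℝ X] [AddCommGroup F]
    [Module ℝ F] (p : Seminorm ℝ X) (q s : Seminorm ℝ F) (φ : F →ₗ[ℝ] X) : Seminorm ℝ (X × F) :=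
  infConv (p.comp (LinearMap.fst ℝ X F) + q.comp (LinearMap.snd ℝ X F)) s
    (φ.prod (-LinearMap.id))

section amalgam

variable {X F : Type*} [AddCommGroup X] [Module ℝ X] [AddCommGroup F]
    [Module ℝ F] (p : Seminorm ℝ X) (q s : Seminorm ℝ F) (φ : F →ₗ[ℝ] X)

theorem amalgam_le (x : X) (b w : F) :
    amalgam p q s φ (x, b) ≤ p (x - φ w) + q (b + w) + s w := by
  simpa [amalgam] using infConv_le (p.comp (LinearMap.fst ℝ X F) + q.comp (LinearMap.snd ℝ X F)) s
    (φ.prod (-LinearMap.id)) (x, b) w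

theorem le_amalgam {x : X} {b : F} {c : ℝ} (h : ∀ w, c ≤ p (x - φ w) + q (b + w) + s w) :
    c ≤ amalgam p q s φ (x, b) :=
  le_infConv _ _ _ fun w => by simpa using h w

/-- By the triangle inequality `p x ≤ p (x - φ w) + p (φ w)`, and `p (φ w) ≤ q w + s w`: a detour
through `F` is never shorter. `amalgam_right` is the mirror image. -/
theorem amalgam_left (h : ∀ x, |p (φ x) - q x| ≤ s x) (x : X) : amalgam p q s φ (x, 0) = p x := by
  refine le_antisymm (by simpa using amalgam_le p q s φ x 0 0) (le_amalgam _ _ _ _ fun w => ?_)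
  have h1 := (abs_le.1 (h w)).2
  have h2 := map_add_le_add p (x - φ w) (φ w)
  rw [sub_add_cancel] at h2
  rw [zero_add]
  linarith

theorem amalgam_right (h : ∀ x, |p (φ x) - q x| ≤ s x) (b : F) : amalgam p q s φ (0, b) = q b := by
  refine le_antisymm (by simpa using amalgam_le p q s φ 0 b 0) (le_amalgam _ _ _ _ fun w => ?_)
  have h1 := (abs_le.1 (h w)).1
  have h2 := map_sub_le_add q (b + w) w
  rw [add_sub_cancel_right] at h2
  rw [zero_sub, map_neg_eq_map]
  linarith

theorem amalgam_graph_le (w : F) : amalgam p q s φ (φ w, -w) ≤ s w := by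
  simpa using amalgam_le p q s φ (φ w) (-w) w

end amalgam

/-! ### Generic seminorms -/

/-- The functions on `X` that are `1`-Lipschitz seminorms. -/
def lipSeminorms (X : Type*) [NormedAddCommGroup X] [NormedSpace ℝ X] : Set (X → ℝ) :=
  {f | (∀ x y, f (x + y) ≤ f x + f y) ∧ (∀ (c : ℝ) x, f (c • x) = ‖c‖ * f x) ∧
    ∀ x, f x ∈ Set.Icc 0 ‖x‖}

section

variable {X : Type*} [NormedAddCommGroup X] [NormedSpace ℝ X]

/-- Tychonoff: the conditions are closed and confine `f x` to the interval `[0, ‖x‖]`. Compactness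
is what makes Baire's theorem available. -/
theorem isCompact_lipSeminorms : IsCompact (lipSeminorms X) := by
  refine (isCompact_univ_pi fun x : X => isCompact_Icc (a := (0 : ℝ)) (b := ‖x‖)).of_isClosed_subset
    ?_ fun f hf x _ => hf.2.2 x
  simp only [lipSeminorms, Set.ofPred_and, Set.ofPred_forall]
  refine IsClosed.inter ?_ (IsClosed.inter ?_ ?_)
  · exact isClosed_iInter fun x => isClosed_iInter fun y =>
      isClosed_le (continuous_apply _) ((continuous_apply x).add (continuous_apply y))
  · exact isClosed_iInter fun c => isClosed_iInter fun x =>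
      isClosed_eq (continuous_apply _) (continuous_const.mul (continuous_apply _))
  · exact isClosed_iInter fun x => isClosed_Icc.preimage (continuous_apply x)

variable (X) in
/-- The compact space of `1`-Lipschitz seminorms, with pointwise convergence. -/
abbrev LipSeminorm : Type _ := lipSeminorms X

instance : CompactSpace (LipSeminorm X) :=
  isCompact_iff_compactSpace.1 isCompact_lipSeminorms

/-- The bundled seminorm of a member of `lipSeminorms X`. -/
def LipSeminorm.toSeminorm (f : LipSeminorm X) : Seminorm ℝ X :=
  Seminorm.of f.1 f.2.1 f.2.2.1

theorem LipSeminorm.toSeminorm_apply (f : LipSeminorm X) (x : X) : f.toSeminorm x = f.1 x := rfl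

theorem LipSeminorm.le_norm (f : LipSeminorm X) (x : X) : f.toSeminorm x ≤ ‖x‖ := (f.2.2.2 x).2

/-- A `1`-Lipschitz seminorm as a member of `lipSeminorms X`. -/
def LipSeminorm.mk (q : Seminorm ℝ X) (h : ∀ x, q x ≤ ‖x‖) : LipSeminorm X :=
  ⟨q, map_add_le_add q, map_smul_eq_mul q, fun x => ⟨apply_nonneg q x, h x⟩⟩

/-- Pointwise convergence suffices for joint continuity because the seminorms are all `1`-Lipschitz.
-/
theorem LipSeminorm.continuous_eval :
    Continuous fun z : LipSeminorm X × X => z.1.toSeminorm z.2 := by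
  refine continuous_iff_continuousAt.2 fun ⟨f, x⟩ => ?_
  rw [ContinuousAt, Metric.tendsto_nhds]
  intro ε hε
  have h1 : ∀ᶠ z : LipSeminorm X × X in nhds (f, x), dist (z.1.1 x) (f.1 x) < ε / 2 :=
    (((continuous_apply x).comp (continuous_subtype_val.comp continuous_fst)).tendsto
      ((f, x) : LipSeminorm X × X)).eventually (Metric.ball_mem_nhds _ (half_pos hε))
  have h2 : ∀ᶠ z : LipSeminorm X × X in nhds (f, x), dist z.2 x < ε / 2 :=
    (continuous_snd.tendsto ((f, x) : LipSeminorm X × X)).eventually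
      (Metric.ball_mem_nhds _ (half_pos hε))
  filter_upwards [h1, h2] with z hz1 hz2
  have h3 := (lipschitzWith_one_of_le _ z.1.le_norm).dist_le_mul z.2 x
  rw [NNReal.coe_one, one_mul] at h3
  have h4 := dist_triangle (z.1.toSeminorm z.2) (z.1.1 x) (f.1 x)
  simp only [LipSeminorm.toSeminorm_apply] at *
  linarith

/-- A task for a seminorm `q` on `X`: correct the map `φ`, along which `q` is `s`-close to `q'`,
to a map along which `q` is `ε`-close to `q'`, under the additional requirement `R`. -/
structure Task (X : Type*) [NormedAddCommGroup X] [NormedSpace ℝ X] where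
  /-- the dimension -/
  m : ℕ
  /-- the map to be corrected -/
  φ : (Fin m → ℝ) →ₗ[ℝ] X
  /-- the seminorm to be realized -/
  q' : Seminorm ℝ (Fin m → ℝ)
  /-- the defect of `φ` -/
  s : Seminorm ℝ (Fin m → ℝ)
  /-- an additional requirement on the corrected map -/
  R : ((Fin m → ℝ) →ₗ[ℝ] X) → Prop
  /-- the permitted error -/
  ε : ℝ

/-- The task is realizable over every finite dimensional subspace. -/
def Task.Realizable (τ : Task X) : Prop :=
  0 < τ.ε ∧ ∀ q : Seminorm ℝ X, (∀ x, q x ≤ ‖x‖) → (∀ x, |q (τ.φ x) - τ.q' x| ≤ τ.s x) →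
    ∀ (k : ℕ) (ν : (Fin k → ℝ) →ₗ[ℝ] X), Function.Injective ν →
      LinearMap.range τ.φ ≤ LinearMap.range ν → ∀ η : ℝ, 0 < η → η < 1 →
      ∃ ψ : (Fin τ.m → ℝ) →ₗ[ℝ] X, τ.R ψ ∧
        ∀ n b, (1 - η) * amalgam q τ.q' τ.s τ.φ (ν n, b) ≤ ‖ν n + ψ b‖

/-- The seminorm `q` can perform the task, if it has to. -/
def Task.Solved (τ : Task X) (q : Seminorm ℝ X) : Prop :=
  (∀ x, |q (τ.φ x) - τ.q' x| ≤ τ.s x) → ∃ ψ : (Fin τ.m → ℝ) →ₗ[ℝ] X, τ.R ψ ∧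
    ∀ x ∈ Metric.sphere (0 : Fin τ.m → ℝ) 1,
      |q (ψ x) - τ.q' x| < τ.ε ∧ q (τ.φ x - ψ x) < τ.s x + τ.ε

/-- Violating the premise is an open condition at some `x`. For a fixed `ψ`, the strict inequalities
over the compact sphere persist under small perturbations of the seminorm. -/
theorem Task.isOpen_solved (τ : Task X) : IsOpen {f : LipSeminorm X | τ.Solved f.toSeminorm} := by
  have : {f : LipSeminorm X | τ.Solved f.toSeminorm} =
      (⋃ x, {f : LipSeminorm X | τ.s x < |f.toSeminorm (τ.φ x) - τ.q' x|}) ∪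
      ⋃ ψ : (Fin τ.m → ℝ) →ₗ[ℝ] X, ⋃ _ : τ.R ψ, {f : LipSeminorm X |
        ∀ x ∈ Metric.sphere (0 : Fin τ.m → ℝ) 1, |f.toSeminorm (ψ x) - τ.q' x| < τ.ε ∧
          f.toSeminorm (τ.φ x - ψ x) < τ.s x + τ.ε} := by
    ext f
    simp only [Task.Solved, Set.mem_ofPred_eq, Set.mem_union, Set.mem_iUnion, exists_prop]
    rw [imp_iff_not_or]
    push Not
    rfl
  rw [this]
  have hev : ∀ T : (Fin τ.m → ℝ) →ₗ[ℝ] X,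
      Continuous fun z : LipSeminorm X × (Fin τ.m → ℝ) => z.1.toSeminorm (T z.2) := fun T =>
    LipSeminorm.continuous_eval.comp
      (continuous_fst.prodMk (T.continuous_of_finiteDimensional.comp continuous_snd))
  have hq := (seminorm_continuous_pi τ.q').comp
    (continuous_snd : Continuous (Prod.snd : LipSeminorm X × (Fin τ.m → ℝ) → _))
  have hs := (seminorm_continuous_pi τ.s).comp
    (continuous_snd : Continuous (Prod.snd : LipSeminorm X × (Fin τ.m → ℝ) → _))
  refine IsOpen.union (isOpen_iUnion fun x => ?_) (isOpen_iUnion fun ψ => isOpen_iUnion fun _ => ?_)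
  · exact isOpen_lt continuous_const
      (((continuous_apply (τ.φ x)).comp continuous_subtype_val).sub continuous_const).abs
  · refine isOpen_iff_eventually.2 fun f hf => ?_
    refine (isCompact_sphere (0 : Fin τ.m → ℝ) 1).eventually_forall_of_forall_eventually
      (P := fun (f : LipSeminorm X) x => |f.toSeminorm (ψ x) - τ.q' x| < τ.ε ∧
          f.toSeminorm (τ.φ x - ψ x) < τ.s x + τ.ε) fun x hx => ?_
    exact ((isOpen_lt ((hev ψ).sub hq).abs continuous_const).inter
      (isOpen_lt (hev (τ.φ - ψ)) (hs.add continuous_const))).mem_nhds (hf x hx)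

/-- On the span `N` of `t` and the range of `φ`, together with the range of the `ψ` supplied by
realizability, prescribe `1 - δ` times the amalgam of `q` with `q'`. The infimal convolution with
the norm extends this to a `1`-Lipschitz seminorm on `X`. It equals `(1 - δ) q` on `N`, hence is
close to `q` on `t`. -/
theorem exists_solved_near {τ : Task X} (hτ : τ.Realizable) (q : Seminorm ℝ X)
    (hq : ∀ x, q x ≤ ‖x‖) (t : Finset X) {η : ℝ} (hη : 0 < η) :
    ∃ q₁ : Seminorm ℝ X, (∀ x, q₁ x ≤ ‖x‖) ∧ τ.Solved q₁ ∧ ∀ x ∈ t, |q₁ x - q x| < η := by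
  by_cases hd : ∀ x, |q (τ.φ x) - τ.q' x| ≤ τ.s x
  -- If `q` violates the premise of the task, it solves the task vacuously and needs no change.
  swap
  · exact ⟨q, hq, fun h => absurd h hd, fun x _ => by simpa using hη⟩
  obtain ⟨hε, hτ⟩ := hτ
  obtain ⟨C, hC, hCq⟩ := exists_seminorm_le_mul_norm τ.q'
  -- The factor `1 - δ` costs at most `δ * M` on `t` and at most `δ * C` on the unit sphere.
  set M : ℝ := ∑ x ∈ t, ‖x‖ with hM
  have hM0 : 0 ≤ M := Finset.sum_nonneg fun x _ => norm_nonneg x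
  obtain ⟨δ, hδ0, hδ1, hδη, hδε⟩ : ∃ δ : ℝ, 0 < δ ∧ δ < 1 ∧ δ * M < η ∧ δ * C < τ.ε := by
    refine ⟨min (1 / 2) (min (η / (M + 1)) (τ.ε / (C + 1))), by positivity, ?_, ?_, ?_⟩
    · exact (min_le_left _ _).trans_lt (by norm_num)
    · calc _ ≤ η / (M + 1) * M :=
            mul_le_mul_of_nonneg_right ((min_le_right _ _).trans (min_le_left _ _)) hM0
        _ < η := by rw [div_mul_eq_mul_div, div_lt_iff₀ (by positivity)]; nlinarith
    · calc _ ≤ τ.ε / (C + 1) * C :=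
            mul_le_mul_of_nonneg_right ((min_le_right _ _).trans (min_le_right _ _)) hC.le
        _ < τ.ε := by rw [div_mul_eq_mul_div, div_lt_iff₀ (by positivity)]; nlinarith
  set N : Submodule ℝ X := Submodule.span ℝ (t : Set X) ⊔ LinearMap.range τ.φ with hN
  have : FiniteDimensional ℝ (Submodule.span ℝ (t : Set X)) :=
    FiniteDimensional.span_finset ℝ t
  have : FiniteDimensional ℝ N := inferInstance
  let e : (Fin (Module.finrank ℝ N) → ℝ) ≃ₗ[ℝ] N := (Module.finBasis ℝ N).equivFun.symm
  let ν : (Fin (Module.finrank ℝ N) → ℝ) →ₗ[ℝ] X := N.subtype ∘ₗ e.toLinearMap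
  have hν : ∀ x ∈ N, ∃ n, ν n = x := fun x hx => ⟨e.symm ⟨x, hx⟩, by simp [ν]⟩
  obtain ⟨ψ, hR, hψ⟩ := hτ q hq hd _ ν (N.injective_subtype.comp e.injective)
    (fun x hx => hν x ((le_sup_right : LinearMap.range τ.φ ≤ N) hx)) δ hδ0 hδ1
  set A := amalgam q τ.q' τ.s τ.φ with hA
  let T : ((Fin (Module.finrank ℝ N) → ℝ) × (Fin τ.m → ℝ)) →ₗ[ℝ] X :=
    ν ∘ₗ LinearMap.fst ℝ _ _ + ψ ∘ₗ LinearMap.snd ℝ _ _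
  let j : ((Fin (Module.finrank ℝ N) → ℝ) × (Fin τ.m → ℝ)) →ₗ[ℝ] X × (Fin τ.m → ℝ) :=
    ν.prodMap LinearMap.id
  let δ' : NNReal := ⟨1 - δ, by linarith⟩
  let q₁ : Seminorm ℝ X := infConv (normSeminorm ℝ X) (δ' • A.comp j) T
  have hq₁ : ∀ n b, q₁ (ν n + ψ b) = (1 - δ) * A (ν n, b) := by
    intro n b
    refine le_antisymm (infConv_apply_le (normSeminorm ℝ X) (δ' • A.comp j) T (n, b)) ?_
    refine le_infConv _ _ _ fun ⟨n', b'⟩ => ?_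
    change (1 - δ) * A (ν n, b) ≤ ‖ν n + ψ b - (ν n' + ψ b')‖ + (1 - δ) * A (ν n', b')
    -- Realizability bounds the norm of the difference from below by `1 - δ` times its amalgam;
    -- hence the convolution does not lower the prescribed values.
    have h1 := hψ (n - n') (b - b')
    have h2 := map_add_le_add A (ν (n - n'), b - b') (ν n', b')
    rw [Prod.mk_add_mk, map_sub, sub_add_cancel, sub_add_cancel] at h2
    rw [map_sub, map_sub, sub_add_sub_comm] at h1
    have h3 := mul_le_mul_of_nonneg_left h2 (show 0 ≤ 1 - δ by linarith)
    linarith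
  have hq₁q : ∀ x ∈ N, q₁ x = (1 - δ) * q x := by
    intro x hx
    obtain ⟨n, rfl⟩ := hν x hx
    simpa [hA, amalgam_left q τ.q' τ.s τ.φ hd] using hq₁ n 0
  refine ⟨q₁, fun x => infConv_le_left _ _ _ x, fun _ => ⟨ψ, hR, fun x hx => ?_⟩, fun x hx => ?_⟩
  · rw [mem_sphere_zero_iff_norm] at hx
    constructor
    · have h1 := hq₁ 0 x
      rw [map_zero, zero_add, hA, amalgam_right q τ.q' τ.s τ.φ hd] at h1
      have h2 := hCq x
      rw [hx, mul_one] at h2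
      have h3 := apply_nonneg τ.q' x
      rw [h1, show (1 - δ) * τ.q' x - τ.q' x = -(δ * τ.q' x) by ring, abs_neg,
        abs_of_nonneg (by positivity)]
      nlinarith
    · obtain ⟨n, hn⟩ := hν (τ.φ x) ((le_sup_right : LinearMap.range τ.φ ≤ N) ⟨x, rfl⟩)
      have h1 := hq₁ n (-x)
      have h2 := amalgam_graph_le q τ.q' τ.s τ.φ x
      rw [hn, map_neg, ← sub_eq_add_neg] at h1
      rw [← hA] at h2
      have h3 := apply_nonneg A (τ.φ x, -x)
      rw [h1]
      nlinarith
  · rw [hq₁q x ((le_sup_left : Submodule.span ℝ (t : Set X) ≤ N) (Submodule.subset_span hx)),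
      show (1 - δ) * q x - q x = -(δ * q x) by ring, abs_neg,
      abs_of_nonneg (mul_nonneg hδ0.le (apply_nonneg q x))]
    have h1 : ‖x‖ ≤ M := Finset.single_le_sum (f := fun x => ‖x‖) (fun i _ => norm_nonneg i) hx
    have h2 := hq x
    nlinarith

theorem Task.dense_solved {τ : Task X} (hτ : τ.Realizable) :
    Dense {f : LipSeminorm X | τ.Solved f.toSeminorm} := by
  intro f
  rw [mem_closure_iff_nhds]
  intro U hU
  obtain ⟨V, hV, hVU⟩ := mem_nhds_induced _ _ _ |>.1 hU
  rw [nhds_pi, Filter.mem_pi] at hV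
  obtain ⟨I, hI, W, hW, hWV⟩ := hV
  have : ∀ x, ∃ η > 0, Metric.ball (f.1 x) η ⊆ W x := fun x => Metric.mem_nhds_iff.1 (hW x)
  choose η hη hηW using this
  obtain ⟨η₀, hη₀, hη₀le⟩ : ∃ η₀ > 0, ∀ x ∈ hI.toFinset, η₀ ≤ η x := by
    rcases hI.toFinset.eq_empty_or_nonempty with h | h
    · exact ⟨1, one_pos, by simp [h]⟩
    · exact ⟨hI.toFinset.inf' h η, (Finset.lt_inf'_iff h).2 fun x _ => hη x,
        fun x hx => Finset.inf'_le _ hx⟩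
  obtain ⟨q₁, hq₁, hsol, hnear⟩ := exists_solved_near hτ f.toSeminorm f.le_norm hI.toFinset hη₀
  refine ⟨LipSeminorm.mk q₁ hq₁, hVU (hWV fun x hx => hηW x ?_), hsol⟩
  have hx' := hI.mem_toFinset.2 hx
  exact (hnear x hx').trans_le (hη₀le x hx')

theorem exists_generic_seminorm {ι : Type*} [Countable ι] (τ : ι → Task X)
    (hτ : ∀ i, (τ i).Realizable) :
    ∃ q : Seminorm ℝ X, (∀ x, q x ≤ ‖x‖) ∧ ∀ i, (τ i).Solved q := by
  have : Nonempty (LipSeminorm X) := ⟨LipSeminorm.mk 0 fun x => norm_nonneg x⟩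
  obtain ⟨f, hf⟩ := (dense_iInter_of_isOpen (fun i => (τ i).isOpen_solved)
    fun i => Task.dense_solved (hτ i)).nonempty
  exact ⟨f.toSeminorm, f.le_norm, Set.mem_iInter.1 hf⟩

end

/-! ### Dense families of data -/

/-- The approximants are taken from `T` itself, so that approximating data keep the constraints that
define their set. -/
theorem exists_countable_subset_dist_lt {T Y : Type*} [PseudoMetricSpace Y]
    [SecondCountableTopology Y] (f : T → Y) :
    ∃ s : Set T, s.Countable ∧ ∀ t, ∀ ε : ℝ, 0 < ε → ∃ t' ∈ s, dist (f t) (f t') < ε := by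
  obtain ⟨c, hc, hd⟩ := TopologicalSpace.exists_countable_dense (Set.range f)
  choose g hg using fun y : Set.range f => y.2
  refine ⟨g '' c, hc.image g, fun t ε hε => ?_⟩
  obtain ⟨y, hyc, hy⟩ := hd.exists_dist_lt ⟨f t, t, rfl⟩ hε
  refine ⟨g y, ⟨y, hyc, rfl⟩, ?_⟩
  rw [hg]
  exact hy

/-- A linear map into `X` together with three seminorms: the norm to be realized, the seminorm to
be realized, and the defect of the map. -/
structure Datum (X : Type*) [NormedAddCommGroup X] [NormedSpace ℝ X] (m : ℕ) where
  /-- the map -/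
  φ : (Fin m → ℝ) →ₗ[ℝ] X
  /-- the norm to be realized -/
  p : Seminorm ℝ (Fin m → ℝ)
  /-- the seminorm to be realized -/
  q : Seminorm ℝ (Fin m → ℝ)
  /-- the defect -/
  r : Seminorm ℝ (Fin m → ℝ)

variable {X : Type*} [NormedAddCommGroup X] [NormedSpace ℝ X]

/-- Two data are uniformly `η`-close. -/
structure Datum.Close {m : ℕ} (η : ℝ) (t t' : Datum X m) : Prop where
  φ_le : ∀ x, ‖t.φ x - t'.φ x‖ ≤ η * ‖x‖
  p_le : ∀ x, |t.p x - t'.p x| ≤ η * ‖x‖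
  q_le : ∀ x, |t.q x - t'.q x| ≤ η * ‖x‖
  r_le : ∀ x, |t.r x - t'.r x| ≤ η * ‖x‖

theorem linearMap_pi_norm_le {m : ℕ} (φ : (Fin m → ℝ) →ₗ[ℝ] X) {η : ℝ}
    (h : ∀ i, ‖φ (Pi.single i 1)‖ ≤ η) (x : Fin m → ℝ) : ‖φ x‖ ≤ m * η * ‖x‖ := by
  rw [LinearMap.pi_apply_eq_sum_univ φ x]
  refine (norm_sum_le _ _).trans ?_
  calc ∑ i, ‖x i • φ (fun j => if i = j then 1 else 0)‖ ≤ ∑ _i : Fin m, η * ‖x‖ := by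
        refine Finset.sum_le_sum fun i _ => ?_
        rw [norm_smul, mul_comm]
        refine mul_le_mul ?_ (norm_le_pi_norm x i) (norm_nonneg _) ((norm_nonneg _).trans (h i))
        have h1 : (fun j => if i = j then (1 : ℝ) else 0) = Pi.single i 1 := by
          funext j
          simp [Pi.single_apply, eq_comm]
        rw [h1]
        exact h i
    _ = m * η * ‖x‖ := by simp [mul_assoc]

/-- The restriction of a seminorm to the unit ball, as a continuous function. -/
noncomputable def ballRestrict {m : ℕ} (q : Seminorm ℝ (Fin m → ℝ)) :
    C(Metric.closedBall (0 : Fin m → ℝ) 1, ℝ) :=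
  ⟨fun x => q x, (seminorm_continuous_pi q).comp continuous_subtype_val⟩

theorem abs_sub_le_of_dist_ballRestrict {m : ℕ} {q q' : Seminorm ℝ (Fin m → ℝ)} {η : ℝ}
    (h : dist (ballRestrict q) (ballRestrict q') ≤ η) (x : Fin m → ℝ) :
    |q x - q' x| ≤ η * ‖x‖ := by
  rcases eq_or_ne x 0 with rfl | hx
  · simp
  have hx' := norm_pos_iff.2 hx
  have h1 := (ContinuousMap.dist_apply_le_dist (f := ballRestrict q) (g := ballRestrict q')
    ⟨‖x‖⁻¹ • x, by simp [norm_smul, hx'.ne']⟩).trans h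
  change dist (q (‖x‖⁻¹ • x)) (q' (‖x‖⁻¹ • x)) ≤ η at h1
  rw [map_smul_eq_mul, map_smul_eq_mul, Real.dist_eq, ← mul_sub, abs_mul, norm_inv, norm_norm,
    abs_of_nonneg (inv_nonneg.2 hx'.le), inv_mul_le_iff₀ hx'] at h1
  linarith

/-- A datum is measured by its values on the standard basis and by three continuous functions on the
compact unit ball, that is, by a point of a separable metric space. -/
theorem exists_countable_data [TopologicalSpace.SeparableSpace X] {m : ℕ}
    (V : Set (Datum X m)) :
    ∃ s ⊆ V, s.Countable ∧ ∀ t ∈ V, ∀ η : ℝ, 0 < η → ∃ t' ∈ s, t.Close η t' := by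
  have : SecondCountableTopology X := UniformSpace.secondCountable_of_separable X
  obtain ⟨s, hs, hd⟩ := exists_countable_subset_dist_lt fun t : V =>
    ((fun i => t.1.φ (Pi.single i 1) : Fin m → X), ballRestrict t.1.p, ballRestrict t.1.q,
      ballRestrict t.1.r)
  refine ⟨Subtype.val '' s, by simp, hs.image _, fun t ht η hη => ?_⟩
  -- Passing from basis vectors to all vectors costs a factor `m`.
  obtain ⟨t', ht', hlt⟩ := hd ⟨t, ht⟩ (η / (m + 1)) (by positivity)
  have hle : η / (m + 1) ≤ η := div_le_self hη.le (by simp)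
  simp only [Prod.dist_eq, max_lt_iff] at hlt
  obtain ⟨h1, h2, h3, h4⟩ := hlt
  refine ⟨t', ⟨t', ht', rfl⟩, fun x => ?_, fun x => ?_, fun x => ?_, fun x => ?_⟩
  · have h5 := linearMap_pi_norm_le (t.φ - t'.1.φ) (η := η / (m + 1)) (fun i => by
      rw [LinearMap.sub_apply, ← dist_eq_norm]
      exact ((dist_le_pi_dist _ _ i).trans_lt h1).le) x
    refine h5.trans (mul_le_mul_of_nonneg_right ?_ (norm_nonneg x))
    rw [mul_div_assoc', div_le_iff₀ (by positivity)]
    nlinarith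
  · exact abs_sub_le_of_dist_ballRestrict (h2.le.trans hle) x
  · exact abs_sub_le_of_dist_ballRestrict (h3.le.trans hle) x
  · exact abs_sub_le_of_dist_ballRestrict (h4.le.trans hle) x

/-- The task to correct the map of a datum. -/
def Datum.task {m : ℕ} (t : Datum X m) (R : ((Fin m → ℝ) →ₗ[ℝ] X) → Prop) (ε : ℝ) : Task X :=
  ⟨m, t.φ, t.q, t.r, R, ε⟩

theorem Datum.realizable_task {m : ℕ} {t : Datum X m} {R : ((Fin m → ℝ) →ₗ[ℝ] X) → Prop} {ε : ℝ}
    (hε : 0 < ε)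
    (h : ∀ S : Seminorm ℝ X, (∀ x, S x ≤ ‖x‖) → (∀ x, |S (t.φ x) - t.q x| ≤ t.r x) →
      ∀ (k : ℕ) (ν : (Fin k → ℝ) →ₗ[ℝ] X), Function.Injective ν →
        LinearMap.range t.φ ≤ LinearMap.range ν → ∀ η : ℝ, 0 < η → η < 1 →
        ∃ ψ : (Fin m → ℝ) →ₗ[ℝ] X, R ψ ∧
          ∀ n b, (1 - η) * amalgam S t.q t.r t.φ (ν n, b) ≤ ‖ν n + ψ b‖) :
    (t.task R ε).Realizable :=
  ⟨hε, h⟩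

/-- A generic `S` solves the tasks of a countable dense family of data at tolerances `1 / (n + 1)`.
An arbitrary datum is only approximated by one of these; applications absorb the discrepancy by
enlarging the defect beforehand. -/
theorem exists_seminorm_solving [TopologicalSpace.SeparableSpace X]
    (V : ∀ m, Set (Datum X m)) (R : ∀ m, Datum X m → ℝ → ((Fin m → ℝ) →ₗ[ℝ] X) → Prop)
    (hR : ∀ m, ∀ t ∈ V m, ∀ ε : ℝ, 0 < ε → (t.task (R m t ε) ε).Realizable) :
    ∃ S : Seminorm ℝ X, (∀ x, S x ≤ ‖x‖) ∧ ∀ m, ∀ t ∈ V m, ∀ ε : ℝ, 0 < ε →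
      ∃ t' ∈ V m, ∃ ε', 0 < ε' ∧ ε' ≤ ε ∧ t.Close ε t' ∧ (t'.task (R m t' ε') ε').Solved S := by
  choose s hsV hsc hsd using fun m => exists_countable_data (V m)
  have := fun m => (hsc m).to_subtype
  obtain ⟨S, hS, hsol⟩ := exists_generic_seminorm
    (fun i : (Σ m, s m) × ℕ => i.1.2.1.task (R i.1.1 i.1.2.1 (1 / (i.2 + 1))) (1 / (i.2 + 1)))
    fun i => hR _ _ (hsV _ i.1.2.2) _ Nat.one_div_pos_of_nat
  refine ⟨S, hS, fun m t ht ε hε => ?_⟩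
  obtain ⟨n, hn⟩ := exists_nat_one_div_lt hε
  obtain ⟨t', ht', hc⟩ := hsd m t ht ε hε
  exact ⟨t', hsV m ht', 1 / (n + 1), Nat.one_div_pos_of_nat, hn.le, hc, hsol (⟨m, t', ht'⟩, n)⟩

/-! ### Correcting maps in a Gurarij space -/

/-- Every map that realizes the pair `(p, q)` up to a defect `r` can be corrected, by moving it at
most by the defect, to a map realizing `(p, q)` up to an arbitrarily small error. -/
def Corrects {G : Type*} [NormedAddCommGroup G] [NormedSpace ℝ G] (S : Seminorm ℝ G) {m : ℕ}
    (p q : Seminorm ℝ (Fin m → ℝ)) : Prop :=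
  ∀ (φ : (Fin m → ℝ) →ₗ[ℝ] G) (r : Seminorm ℝ (Fin m → ℝ)),
    (∀ x, |‖φ x‖ - p x| ≤ r x) → (∀ x, |S (φ x) - q x| ≤ r x) → ∀ ε : ℝ, 0 < ε →
      ∃ ψ : (Fin m → ℝ) →ₗ[ℝ] G, ∀ x, |‖ψ x‖ - p x| ≤ ε * ‖x‖ ∧ |S (ψ x) - q x| ≤ ε * ‖x‖ ∧
        ‖φ x - ψ x‖ ≤ r x + ε * ‖x‖

theorem IsGurarij.exists_extension {G : Type u} [NormedAddCommGroup G] [NormedSpace ℝ G]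
    (hG : IsGurarij G) {V W : Type} [AddCommGroup V] [Module ℝ V] [AddCommGroup W] [Module ℝ W]
    [FiniteDimensional ℝ W] (P : Seminorm ℝ W) (hP : ∀ w, P w = 0 → w = 0) (i : V →ₗ[ℝ] W)
    (hi : Function.Injective i) (φ : V →ₗ[ℝ] G) (hφ : ∀ v, ‖φ v‖ = P (i v)) {ε : ℝ} (hε : 0 < ε) :
    ∃ ψ : W →ₗ[ℝ] G, (∀ v, ψ (i v) = φ v) ∧
      ∀ w, (1 - ε) * P w ≤ ‖ψ w‖ ∧ ‖ψ w‖ ≤ (1 + ε) * P w := by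
  let : Norm W := ⟨P⟩
  have core : NormedSpace.Core ℝ W :=
    { norm_nonneg := apply_nonneg P
      norm_smul := map_smul_eq_mul P
      norm_triangle := map_add_le_add P
      norm_eq_zero_iff := fun w => ⟨hP w, fun h => h ▸ map_zero P⟩ }
  let : NormedAddCommGroup W := NormedAddCommGroup.ofCore core
  let : NormedSpace ℝ W := NormedSpace.ofCore core
  let e := LinearEquiv.ofInjective i hi
  have he : ∀ v, φ (e.symm ⟨i v, v, rfl⟩) = φ v := fun v =>
    congrArg φ (e.symm_apply_apply v)
  let φ' : LinearMap.range i →ₗᵢ[ℝ] G := ⟨φ ∘ₗ e.symm.toLinearMap, by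
    rintro ⟨_, v, rfl⟩
    change ‖φ (e.symm ⟨i v, v, rfl⟩)‖ = P (i v)
    rw [he, hφ]⟩
  obtain ⟨ψ, hψ, hψε⟩ := hG.extension W (LinearMap.range i) φ' ε hε
  exact ⟨ψ, fun v => (hψ ⟨i v, v, rfl⟩).trans (he v), hψε⟩

theorem amalgam_mono {X F : Type*} [AddCommGroup X] [Module ℝ X] [AddCommGroup F]
    [Module ℝ F] {p p' : Seminorm ℝ X} {q q' s : Seminorm ℝ F} (φ : F →ₗ[ℝ] X)
    (hp : ∀ x, p x ≤ p' x) (hq : ∀ x, q x ≤ q' x) (z : X × F) :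
    amalgam p q s φ z ≤ amalgam p' q' s φ z := by
  obtain ⟨x, b⟩ := z
  refine le_amalgam _ _ _ _ fun w => (amalgam_le p q s φ x b w).trans ?_
  have := hp (x - φ w)
  have := hq (b + w)
  linarith

/-- The data in `X` for which the norm dominates the seminorm and the map realizes the norm up to
the defect. -/
def normedData (X : Type*) [NormedAddCommGroup X] [NormedSpace ℝ X] (m : ℕ) : Set (Datum X m) :=
  {t | (∀ x, t.q x ≤ t.p x) ∧ ∀ x, |‖t.φ x‖ - t.p x| ≤ t.r x}

/-- The map `ψ` almost realizes the norm of the datum `t` and is close to its map. -/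
def Datum.Corrected {X : Type*} [NormedAddCommGroup X] [NormedSpace ℝ X] (m : ℕ) (t : Datum X m)
    (ε : ℝ) (ψ : (Fin m → ℝ) →ₗ[ℝ] X) : Prop :=
  ∀ x, |‖ψ x‖ - t.p x| ≤ ε * ‖x‖ ∧ ‖t.φ x - ψ x‖ ≤ t.r x + ε * ‖x‖

/-- Amalgamate the norm of `G` with `p` and extend the inclusion `ν` to the amalgam by the Gurarij
property. Since `S ≤ ‖·‖` and `q ≤ p`, the amalgam of the seminorms lies below that of the norms,
hence almost below the norm in `G`. -/
theorem IsGurarij.realizable {G : Type u} [NormedAddCommGroup G] [NormedSpace ℝ G]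
    (hG : IsGurarij G) {m : ℕ} {t : Datum G m} (ht : t ∈ normedData G m) {ε : ℝ} (hε : 0 < ε) :
    (t.task (Datum.Corrected m t ε) ε).Realizable := by
  refine Datum.realizable_task hε fun S hS hd k ν hν hrange η hη hη1 => ?_
  obtain ⟨φ, p, q, r⟩ := t
  obtain ⟨hqp, hφp⟩ := ht
  dsimp only at *
  obtain ⟨C, hC, hCp⟩ := exists_seminorm_le_mul_norm p
  obtain ⟨C', hC', hCr⟩ := exists_seminorm_le_mul_norm r
  -- `C` and `C'` pay for the distortion of `p` and `r`; the `2` pays for the extra term `δ * ‖b‖`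
  -- and its distortion.
  obtain ⟨δ, hδ0, hδη, hδ1, hδε⟩ : ∃ δ : ℝ, 0 < δ ∧ δ ≤ η ∧ δ ≤ 1 ∧ δ * (C + C' + 2) ≤ ε := by
    refine ⟨min η (min 1 (ε / (C + C' + 2))), by positivity, min_le_left _ _,
      (min_le_right _ _).trans (min_le_left _ _), ?_⟩
    rw [← le_div_iff₀ (by positivity)]
    exact (min_le_right _ _).trans (min_le_right _ _)
  set A := amalgam (normSeminorm ℝ G) p r φ with hA
  let δ' : NNReal := ⟨δ, hδ0.le⟩
  -- The amalgam may vanish on nonzero vectors; the term `δ * ‖b‖` turns it into a norm.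
  let P : Seminorm ℝ ((Fin k → ℝ) × (Fin m → ℝ)) := A.comp (ν.prodMap LinearMap.id) +
    δ' • (normSeminorm ℝ (Fin m → ℝ)).comp (LinearMap.snd ℝ (Fin k → ℝ) (Fin m → ℝ))
  have hPapp : ∀ n b, P (n, b) = A (ν n, b) + δ * ‖b‖ := fun n b => rfl
  have hA0 : ∀ x, A (x, 0) = ‖x‖ := amalgam_left (normSeminorm ℝ G) p r φ hφp
  have hA1 : ∀ b, A (0, b) = p b := amalgam_right (normSeminorm ℝ G) p r φ hφp
  obtain ⟨Ψ, hΨν, hΨ⟩ := hG.exists_extension P (by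
      rintro ⟨n, b⟩ h
      rw [hPapp] at h
      have h1 := apply_nonneg A (ν n, b)
      have h2 : 0 ≤ δ * ‖b‖ := by positivity
      have h3 : δ * ‖b‖ = 0 := by linarith
      have hb : b = 0 := by simpa [hδ0.ne'] using h3
      subst hb
      rw [hA0, norm_zero, mul_zero, add_zero, norm_eq_zero] at h
      rw [hν (h.trans (map_zero ν).symm)]
      rfl)
    (LinearMap.inl ℝ (Fin k → ℝ) (Fin m → ℝ)) LinearMap.inl_injective ν
    (fun n => by simp [hPapp, hA0]) hδ0
  have hsplit : ∀ n b, Ψ (n, b) = ν n + Ψ (0, b) := fun n b => by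
    rw [← hΨν, LinearMap.inl_apply, ← map_add]
    simp
  refine ⟨Ψ ∘ₗ LinearMap.inr ℝ (Fin k → ℝ) (Fin m → ℝ), fun x => ⟨?_, ?_⟩, fun n b => ?_⟩
  · obtain ⟨h1, h2⟩ := hΨ (0, x)
    rw [hPapp, map_zero, hA1] at h1 h2
    have h3 := hCp x
    have h4 := norm_nonneg x
    have h5 := apply_nonneg p x
    have h6 : δ * p x ≤ δ * (C * ‖x‖) := by gcongr
    have h7 : δ * (C + C' + 2) * ‖x‖ ≤ ε * ‖x‖ := by gcongr
    have h8 : 0 ≤ δ * (C' * ‖x‖) := by positivity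
    have h9 : δ * (δ * ‖x‖) ≤ 1 * (δ * ‖x‖) := by gcongr
    have h10 : 0 ≤ δ * ‖x‖ := by positivity
    simp only [LinearMap.comp_apply, LinearMap.inr_apply, abs_le]
    constructor <;> nlinarith
  · obtain ⟨n, hn⟩ := hrange ⟨x, rfl⟩
    obtain ⟨h1, h2⟩ := hΨ (n, -x)
    have h11 : A (φ x, -x) ≤ r x := amalgam_graph_le (normSeminorm ℝ G) p r φ x
    have h12 := apply_nonneg A (φ x, -x)
    rw [hPapp, hn, norm_neg] at h2
    have h0 : Ψ (n, -x) = φ x - Ψ (0, x) := by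
      rw [hsplit, hn, sub_eq_add_neg, ← map_neg]
      simp
    rw [h0] at h2
    have h3 := hCr x
    have h4 := norm_nonneg x
    have h6 : δ * r x ≤ δ * (C' * ‖x‖) := by gcongr
    have h7 : δ * (C + C' + 2) * ‖x‖ ≤ ε * ‖x‖ := by gcongr
    have h8 : 0 ≤ δ * (C * ‖x‖) := by positivity
    have h9 : δ * (δ * ‖x‖) ≤ 1 * (δ * ‖x‖) := by gcongr
    have h13 : (1 + δ) * A (φ x, -x) ≤ (1 + δ) * r x := by gcongr
    simp only [LinearMap.comp_apply, LinearMap.inr_apply]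
    nlinarith
  · obtain ⟨h1, h2⟩ := hΨ (n, b)
    rw [hsplit, hPapp] at h1
    have h3 := amalgam_mono (s := r) φ (p := S) (p' := normSeminorm ℝ G) hS hqp (ν n, b)
    rw [← hA] at h3
    have h4 := apply_nonneg A (ν n, b)
    refine le_trans ?_ h1
    refine mul_le_mul (by linarith) (h3.trans ?_) (apply_nonneg _ _) (by linarith)
    have : 0 ≤ δ * ‖b‖ := by positivity
    linarith

theorem abs_seminorm_sub_le_of_sphere {G : Type*} [NormedAddCommGroup G] [NormedSpace ℝ G]
    (S : Seminorm ℝ G) {m : ℕ} (ψ : (Fin m → ℝ) →ₗ[ℝ] G) (q : Seminorm ℝ (Fin m → ℝ)) {ε : ℝ}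
    (h : ∀ x ∈ Metric.sphere (0 : Fin m → ℝ) 1, |S (ψ x) - q x| ≤ ε) (x : Fin m → ℝ) :
    |S (ψ x) - q x| ≤ ε * ‖x‖ := by
  rcases eq_or_ne x 0 with rfl | hx
  · simp
  have hx' := norm_pos_iff.2 hx
  have h1 := h (‖x‖⁻¹ • x) (by simp [norm_smul, hx'.ne'])
  rw [map_smul, map_smul_eq_mul, map_smul_eq_mul, ← mul_sub, abs_mul, norm_inv, norm_norm,
    abs_of_nonneg (inv_nonneg.2 hx'.le), inv_mul_le_iff₀ hx'] at h1
  linarith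

theorem seminorm_le_of_sphere {G : Type*} [NormedAddCommGroup G] [NormedSpace ℝ G]
    (S : Seminorm ℝ G) {m : ℕ} (ψ : (Fin m → ℝ) →ₗ[ℝ] G) (q : Seminorm ℝ (Fin m → ℝ)) {ε : ℝ}
    (h : ∀ x ∈ Metric.sphere (0 : Fin m → ℝ) 1, S (ψ x) ≤ q x + ε) (x : Fin m → ℝ) :
    S (ψ x) ≤ q x + ε * ‖x‖ := by
  rcases eq_or_ne x 0 with rfl | hx
  · simp
  have hx' := norm_pos_iff.2 hx
  have h1 := h (‖x‖⁻¹ • x) (by simp [norm_smul, hx'.ne'])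
  rw [map_smul, map_smul_eq_mul, map_smul_eq_mul, norm_inv, norm_norm,
    inv_mul_le_iff₀ hx', mul_add, mul_inv_cancel_left₀ hx'.ne'] at h1
  linarith

theorem Datum.exists_of_solved {G : Type*} [NormedAddCommGroup G] [NormedSpace ℝ G]
    {S : Seminorm ℝ G} {m : ℕ} {t : Datum G m} {R : ((Fin m → ℝ) →ₗ[ℝ] G) → Prop} {ε : ℝ}
    (h : (t.task R ε).Solved S) (hd : ∀ x, |S (t.φ x) - t.q x| ≤ t.r x) :
    ∃ ψ : (Fin m → ℝ) →ₗ[ℝ] G, R ψ ∧ (∀ x, |S (ψ x) - t.q x| ≤ ε * ‖x‖) ∧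
      ∀ x, S (t.φ x - ψ x) ≤ t.r x + ε * ‖x‖ := by
  obtain ⟨ψ, hR, hψ⟩ : ∃ ψ : (Fin m → ℝ) →ₗ[ℝ] G, R ψ ∧
    ∀ x ∈ Metric.sphere (0 : Fin m → ℝ) 1,
      |S (ψ x) - t.q x| < ε ∧ S (t.φ x - ψ x) < t.r x + ε := h hd
  exact ⟨ψ, hR, abs_seminorm_sub_le_of_sphere S ψ t.q fun x hx => (hψ x hx).1.le,
    seminorm_le_of_sphere S (t.φ - ψ) t.r fun x hx => (hψ x hx).2.le⟩

theorem IsGurarij.exists_seminorm_corrects {G : Type u} [NormedAddCommGroup G] [NormedSpace ℝ G]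
    (hG : IsGurarij G) :
    ∃ S : Seminorm ℝ G, (∀ x, S x ≤ ‖x‖) ∧ ∀ (m : ℕ) (p q : Seminorm ℝ (Fin m → ℝ)),
      (∀ x, q x ≤ p x) → Corrects S p q := by
  have := hG.separable
  obtain ⟨S, hS, hsol⟩ := exists_seminorm_solving (normedData G) Datum.Corrected
    fun m t ht ε hε => hG.realizable ht hε
  refine ⟨S, hS, fun m p q hqp φ r hφp hφq ε hε => ?_⟩
  set δ := ε / 8 with hδ
  have hδ0 : 0 < δ := by positivity
  -- Replacing `φ` and `q` by nearby data costs `2 * δ`, and replacing `r` costs `δ`, so a defect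
  -- enlarged by `4 * δ` still covers the new datum. The final displacement is at most `r x + 7 * δ
  -- * ‖x‖`.
  let δ' : NNReal := ⟨4 * δ, by positivity⟩
  obtain ⟨t, ⟨htq, htp⟩, ε', hε'0, hε', hc, hsolt⟩ :=
    hsol m ⟨φ, p, q, r + δ' • normSeminorm ℝ (Fin m → ℝ)⟩
      ⟨hqp, fun x => (hφp x).trans (le_add_of_nonneg_right (by positivity))⟩ δ hδ0
  have hr : ∀ x, |r x + 4 * δ * ‖x‖ - t.r x| ≤ δ * ‖x‖ := hc.r_le
  obtain ⟨ψ, hψ, hψS, -⟩ := Datum.exists_of_solved hsolt fun x => by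
    have h1 := abs_le.1 (hφq x)
    have h2 := abs_le.1 (hc.q_le x)
    have h3 := abs_le.1 (hr x)
    have h4 := abs_le.1 ((abs_seminorm_sub_le S (φ x) (t.φ x)).trans
      ((hS _).trans (hc.φ_le x)))
    dsimp only at h2
    have := norm_nonneg x
    rw [abs_le]
    constructor <;> nlinarith
  refine ⟨ψ, fun x => ?_⟩
  have hx := norm_nonneg x
  have hεx : ε' * ‖x‖ ≤ δ * ‖x‖ := by gcongr
  have h0 : ε * ‖x‖ = 8 * (δ * ‖x‖) := by rw [hδ]; ring
  have h00 : 0 ≤ δ * ‖x‖ := by positivity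
  obtain ⟨h1, h2⟩ := hψ x
  have h1 := abs_le.1 h1
  have h3 := abs_le.1 (hc.p_le x)
  have h4 := abs_le.1 (hc.q_le x)
  have h5 := abs_le.1 (hr x)
  have h6 := hc.φ_le x
  have h7 := abs_le.1 (hψS x)
  dsimp only at h3 h4 h6
  refine ⟨abs_le.2 ⟨by linarith, by linarith⟩, abs_le.2 ⟨by linarith, by linarith⟩, ?_⟩
  have h8 := norm_add_le (φ x - t.φ x) (t.φ x - ψ x)
  rw [sub_add_sub_cancel] at h8
  linarith

/-! ### A separable Banach space that corrects maps -/

/-- The space of finitely supported sequences, with the `ℓ¹` norm. -/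
def FinsuppL1 : Type := ℕ →₀ ℝ

namespace FinsuppL1

noncomputable instance : AddCommGroup FinsuppL1 := inferInstanceAs (AddCommGroup (ℕ →₀ ℝ))

noncomputable instance : Module ℝ FinsuppL1 := inferInstanceAs (Module ℝ (ℕ →₀ ℝ))

/-- The underlying finitely supported function. -/
noncomputable def toFinsupp : FinsuppL1 ≃ₗ[ℝ] (ℕ →₀ ℝ) := LinearEquiv.refl ℝ (ℕ →₀ ℝ)

noncomputable instance : Norm FinsuppL1 := ⟨fun x => (toFinsupp x).sum fun _ a => |a|⟩

theorem norm_def (x : FinsuppL1) : ‖x‖ = (toFinsupp x).sum fun _ a => |a| := rfl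

theorem norm_eq_sum {s : Finset ℕ} {x : FinsuppL1} (h : (toFinsupp x).support ⊆ s) :
    ‖x‖ = ∑ i ∈ s, |toFinsupp x i| :=
  Finsupp.sum_of_support_subset _ h _ fun _ _ => abs_zero

theorem core : NormedSpace.Core ℝ FinsuppL1 where
  norm_nonneg x := Finset.sum_nonneg fun _ _ => abs_nonneg _
  norm_smul c x := by
    rw [norm_eq_sum (x := c • x) (s := (toFinsupp x).support)
      (by rw [map_smul]; exact Finsupp.support_smul), norm_def, Finsupp.sum, Finset.mul_sum]
    refine Finset.sum_congr rfl fun i _ => ?_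
    rw [map_smul, Finsupp.smul_apply, smul_eq_mul, abs_mul, Real.norm_eq_abs]
  norm_triangle x y := by
    classical
    rw [norm_eq_sum (x := x + y) (s := (toFinsupp x).support ∪ (toFinsupp y).support)
        (by rw [map_add]; exact Finsupp.support_add),
      norm_eq_sum (x := x) Finset.subset_union_left, norm_eq_sum (x := y) Finset.subset_union_right,
      ← Finset.sum_add_distrib]
    refine Finset.sum_le_sum fun i _ => ?_
    rw [map_add, Finsupp.add_apply]
    exact abs_add_le _ _
  norm_eq_zero_iff x := by
    constructor
    · intro h
      rw [norm_def, Finsupp.sum, Finset.sum_eq_zero_iff_of_nonneg fun _ _ => abs_nonneg _] at h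
      refine toFinsupp.map_eq_zero_iff.1 (Finsupp.ext fun i => ?_)
      by_contra hi
      exact hi (abs_eq_zero.1 (h i (Finsupp.mem_support_iff.2 hi)))
    · rintro rfl
      rw [norm_def, map_zero, Finsupp.sum_zero_index]

noncomputable instance : NormedAddCommGroup FinsuppL1 := NormedAddCommGroup.ofCore core

noncomputable instance : NormedSpace ℝ FinsuppL1 := NormedSpace.ofCore core

instance : TopologicalSpace.SeparableSpace FinsuppL1 := by
  have h1 := (Set.countable_range
    (Finsupp.basisSingleOne.map toFinsupp.symm : Module.Basis ℕ ℝ FinsuppL1)).isSeparable.span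
      (R := ℝ)
  rw [Module.Basis.span_eq, Submodule.top_coe] at h1
  exact TopologicalSpace.isSeparable_univ_iff.1 h1

/-- The range of `ν` lives on finitely many coordinates; `ψ` uses later ones. -/
theorem exists_norm_add_eq {k : ℕ} (ν : (Fin k → ℝ) →ₗ[ℝ] FinsuppL1) (m : ℕ) :
    ∃ ψ : (Fin m → ℝ) →ₗ[ℝ] FinsuppL1, ∀ n b, ‖ν n + ψ b‖ = ‖ν n‖ + ∑ i, |b i| := by
  classical
  let ν' : (Fin k → ℝ) →ₗ[ℝ] ℕ →₀ ℝ := toFinsupp.toLinearMap ∘ₗ ν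
  obtain ⟨K, hK⟩ : ∃ K : ℕ, ∀ n, (ν' n).support ⊆ Finset.range K := by
    obtain ⟨K, hK⟩ := Finset.exists_nat_subset_range
      (Finset.univ.biUnion fun i => (ν' (fun j => if i = j then 1 else 0)).support)
    refine ⟨K, fun n => ?_⟩
    rw [LinearMap.pi_apply_eq_sum_univ ν' n]
    refine (Finsupp.support_finsetSum).trans ?_
    refine (Finset.biUnion_subset.2 fun i _ => ?_)
    exact Finsupp.support_smul.trans
      ((Finset.subset_biUnion_of_mem (fun i => (ν' (fun j => if i = j then 1 else 0)).support)
        (Finset.mem_univ i)).trans hK)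
  have hinj : Function.Injective fun i : Fin m => K + (i : ℕ) := fun i j h =>
    Fin.ext (Nat.add_left_cancel h)
  let ψ' : (Fin m → ℝ) →ₗ[ℝ] ℕ →₀ ℝ := Finsupp.lmapDomain ℝ ℝ (fun i : Fin m => K + (i : ℕ)) ∘ₗ
    (Finsupp.linearEquivFunOnFinite ℝ ℝ (Fin m)).symm.toLinearMap
  refine ⟨toFinsupp.symm.toLinearMap ∘ₗ ψ', fun n b => ?_⟩
  have hdisj : Disjoint (ν' n).support (ψ' b).support := by
    rw [Finset.disjoint_left]
    intro i hi hi'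
    have h1 := Finset.mem_range.1 (hK n hi)
    have h2 := Finsupp.mapDomain_support hi'
    obtain ⟨j, -, rfl⟩ := Finset.mem_image.1 h2
    omega
  rw [norm_def, norm_def, map_add]
  change (ν' n + ψ' b).sum _ = (ν' n).sum _ + _
  rw [Finsupp.sum_add_index_of_disjoint hdisj]
  congr 1
  change (Finsupp.mapDomain _ _).sum _ = _
  rw [Finsupp.sum_mapDomain_index_inj hinj, Finsupp.sum_fintype _ _ fun _ => abs_zero]
  rfl

/-- The amalgam is at most `S (ν n) + q b`, and a large multiple of a copy of `ℓ¹` on fresh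
coordinates dominates this. -/
theorem realizable {m : ℕ} (t : Datum FinsuppL1 m) {ε : ℝ} (hε : 0 < ε) :
    (t.task (fun _ => True) ε).Realizable := by
  refine Datum.realizable_task hε fun S hS hd k ν hν hrange η hη hη1 => ?_
  obtain ⟨φ, p, q, r⟩ := t
  dsimp only at *
  obtain ⟨C, hC, hCq⟩ := exists_seminorm_le_mul_norm q
  obtain ⟨ψ, hψ⟩ := exists_norm_add_eq ν m
  refine ⟨C • ψ, trivial, fun n b => ?_⟩
  have h1 := amalgam_le S q r φ (ν n) b 0
  rw [map_zero, map_zero, sub_zero, add_zero, add_zero] at h1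
  have h2 := hψ n (C • b)
  have h3 : ‖b‖ ≤ ∑ i, |b i| := by
    refine (pi_norm_le_iff_of_nonneg (Finset.sum_nonneg fun i _ => abs_nonneg _)).2 fun i => ?_
    exact Finset.single_le_sum (f := fun i => |b i|) (fun i _ => abs_nonneg _) (Finset.mem_univ i)
  have h4 : ∑ i, |(C • b) i| = C * ∑ i, |b i| := by
    simp [Finset.mul_sum, abs_mul, abs_of_pos hC]
  rw [map_smul, h4] at h2
  rw [LinearMap.smul_apply, h2]
  have h5 := mul_le_mul_of_nonneg_left h3 hC.le
  have h6 := hS (ν n)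
  have h7 := hCq b
  have h8 := apply_nonneg (amalgam S q r φ) (ν n, b)
  nlinarith

end FinsuppL1

theorem exists_completion {V : Type u} [AddCommGroup V] [Module ℝ V] (q : Seminorm ℝ V) :
    ∃ (G : Type u) (_ : NormedAddCommGroup G) (_ : NormedSpace ℝ G) (ι : V →ₗ[ℝ] G),
      CompleteSpace G ∧ (∀ v, ‖ι v‖ = q v) ∧ DenseRange ι := by
  let : Norm V := ⟨q⟩
  have core : SeminormedSpace.Core ℝ V :=
    { norm_nonneg := apply_nonneg q
      norm_smul := map_smul_eq_mul q
      norm_triangle := map_add_le_add q }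
  let : SeminormedAddCommGroup V := SeminormedAddCommGroup.ofCore core
  let : NormedSpace ℝ V := { norm_smul_le := fun r x => (map_smul_eq_mul q r x).le }
  exact ⟨UniformSpace.Completion V, inferInstance, inferInstance,
    (UniformSpace.Completion.toComplₗᵢ (𝕜 := ℝ) (E := V)).toLinearMap, inferInstance,
    fun v => (UniformSpace.Completion.toComplₗᵢ (𝕜 := ℝ) (E := V)).norm_map v,
    UniformSpace.Completion.denseRange_coe⟩

theorem exists_linearMap_near {V G : Type*} [AddCommGroup V] [Module ℝ V] [NormedAddCommGroup G]
    [NormedSpace ℝ G] {ι : V →ₗ[ℝ] G} (hι : DenseRange ι) {m : ℕ} (φ : (Fin m → ℝ) →ₗ[ℝ] G)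
    {ε : ℝ} (hε : 0 < ε) : ∃ φ' : (Fin m → ℝ) →ₗ[ℝ] V, ∀ x, ‖φ x - ι (φ' x)‖ ≤ ε * ‖x‖ := by
  have h : ∀ i, ∃ v, dist (φ (Pi.single i 1)) (ι v) < ε / (m + 1) := fun i =>
    hι.exists_dist_lt _ (by positivity)
  choose v hv using h
  refine ⟨Fintype.linearCombination ℝ v, fun x => ?_⟩
  have h1 := linearMap_pi_norm_le (φ - ι ∘ₗ Fintype.linearCombination ℝ v)
    (η := ε / (m + 1)) (fun i => by simpa [dist_eq_norm] using (hv i).le) x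
  refine h1.trans (mul_le_mul_of_nonneg_right ?_ (norm_nonneg x))
  rw [mul_div_assoc', div_le_iff₀ (by positivity)]
  nlinarith

/-- The norm of the space is itself the generic object: a generic seminorm on the `ℓ¹` space becomes
a norm in the completion. Maps into the completion are first moved into the dense image. -/
theorem exists_corrects_zero :
    ∃ (G : Type) (_ : NormedAddCommGroup G) (_ : NormedSpace ℝ G),
      CompleteSpace G ∧ TopologicalSpace.SeparableSpace G ∧
      ∀ (m : ℕ) (p : Seminorm ℝ (Fin m → ℝ)), Corrects (0 : Seminorm ℝ G) p 0 := by
  obtain ⟨q, hq, hsol⟩ := exists_seminorm_solving (X := FinsuppL1) (fun _ => Set.univ)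
    (fun _ _ _ _ => True) fun m t _ ε hε => FinsuppL1.realizable t hε
  obtain ⟨G, i1, i2, ι, hc, hι, hd⟩ := exists_completion q
  have hιc : Continuous ι := by
    refine AddMonoidHomClass.continuous_of_bound ι 1 fun x => ?_
    rw [hι, one_mul]
    exact hq x
  refine ⟨G, i1, i2, hc, hd.separableSpace hιc, fun m p φ r hφ _ ε hε => ?_⟩
  set δ := ε / 8 with hδ
  have hδ0 : 0 < δ := by positivity
  obtain ⟨φ', hφ'⟩ := exists_linearMap_near hd φ hδ0
  let δ' : NNReal := ⟨4 * δ, by positivity⟩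
  -- The norm `p` to be realized occupies the seminorm slot; the norm slot holds a dummy `0`. All `8
  -- * δ` are spent in the final estimate.
  obtain ⟨t, -, ε', hε'0, hε', hclose, hsolt⟩ :=
    hsol m ⟨φ', 0, p, r + δ' • normSeminorm ℝ (Fin m → ℝ)⟩ trivial δ hδ0
  have hr : ∀ x, |r x + 4 * δ * ‖x‖ - t.r x| ≤ δ * ‖x‖ := hclose.r_le
  have hp : ∀ x, |p x - t.q x| ≤ δ * ‖x‖ := hclose.q_le
  have hφt : ∀ x, q (φ' x - t.φ x) ≤ δ * ‖x‖ := fun x => (hq _).trans (hclose.φ_le x)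
  obtain ⟨ψ, -, hψ, hψr⟩ := Datum.exists_of_solved hsolt fun x => by
    have h1 := abs_le.1 (hφ x)
    have h2 := abs_le.1 (hp x)
    have h3 := abs_le.1 (hr x)
    have h4 := abs_le.1 ((abs_seminorm_sub_le q (φ' x) (t.φ x)).trans (hφt x))
    have h5 := abs_le.1 ((abs_norm_sub_norm_le (φ x) (ι (φ' x))).trans (hφ' x))
    rw [hι] at h5
    have := norm_nonneg x
    rw [abs_le]
    constructor <;> linarith
  refine ⟨ι ∘ₗ ψ, fun x => ?_⟩
  have hx := norm_nonneg x
  have hεx : ε' * ‖x‖ ≤ δ * ‖x‖ := by gcongr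
  have h0 : ε * ‖x‖ = 8 * (δ * ‖x‖) := by rw [hδ]; ring
  have h00 : 0 ≤ δ * ‖x‖ := by positivity
  have h2 := abs_le.1 (hp x)
  have h3 := abs_le.1 (hr x)
  have h4 := abs_le.1 (hψ x)
  rw [LinearMap.comp_apply, hι]
  refine ⟨abs_le.2 ⟨by linarith, by linarith⟩, by simp; linarith, ?_⟩
  have h5 : ‖φ x - ι (ψ x)‖ ≤ ‖φ x - ι (φ' x)‖ + q (φ' x - ψ x) := by
    rw [← hι, map_sub]
    exact norm_sub_le_norm_sub_add_norm_sub _ _ _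
  have h6 : q (φ' x - ψ x) ≤ q (φ' x - t.φ x) + q (t.φ x - ψ x) := by
    rw [← sub_add_sub_cancel (φ' x) (t.φ x) (ψ x)]
    exact map_add_le_add q _ _
  have h7 := hφ' x
  have h8 := hφt x
  have h9 := hψr x
  linarith

/-! ### Exact correction -/

/-- The error left by one correction is the defect of the next. With errors `δ / 2 ^ n` the
displacements are summable, and the limit has no error. -/
theorem Corrects.exists_exact {G : Type*} [NormedAddCommGroup G] [NormedSpace ℝ G]
    [CompleteSpace G] {S : Seminorm ℝ G} (hS : ∀ x, S x ≤ ‖x‖) {m : ℕ}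
    {p q : Seminorm ℝ (Fin m → ℝ)} (h : Corrects S p q) (φ : (Fin m → ℝ) →ₗ[ℝ] G)
    (r : Seminorm ℝ (Fin m → ℝ)) (hp : ∀ x, |‖φ x‖ - p x| ≤ r x)
    (hq : ∀ x, |S (φ x) - q x| ≤ r x) {ε : ℝ} (hε : 0 < ε) :
    ∃ ψ : (Fin m → ℝ) →ₗ[ℝ] G, ∀ x, ‖ψ x‖ = p x ∧ S (ψ x) = q x ∧
      ‖φ x - ψ x‖ ≤ r x + ε * ‖x‖ := by
  set δ := ε / 8 with hδ
  have hδ0 : 0 < δ := by positivity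
  have hδn : ∀ n : ℕ, 0 < δ / 2 ^ n := fun n => by positivity
  let Good : ℕ → ((Fin m → ℝ) →ₗ[ℝ] G) → Prop := fun n ψ =>
    ∀ x, |‖ψ x‖ - p x| ≤ δ / 2 ^ n * ‖x‖ ∧ |S (ψ x) - q x| ≤ δ / 2 ^ n * ‖x‖
  have step : ∀ n ψ, Good n ψ → ∃ ψ', Good (n + 1) ψ' ∧
      ∀ x, ‖ψ x - ψ' x‖ ≤ 4 * δ * ‖x‖ / 2 / 2 ^ n := by
    intro n ψ hψ
    let d : NNReal := ⟨δ / 2 ^ n, (hδn n).le⟩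
    obtain ⟨ψ', hψ'⟩ := h ψ (d • normSeminorm ℝ (Fin m → ℝ)) (fun x => (hψ x).1)
      (fun x => (hψ x).2) _ (hδn (n + 1))
    refine ⟨ψ', fun x => ⟨(hψ' x).1, (hψ' x).2.1⟩, fun x => ?_⟩
    have h1 : ‖ψ x - ψ' x‖ ≤ δ / 2 ^ n * ‖x‖ + δ / 2 ^ (n + 1) * ‖x‖ := (hψ' x).2.2
    have h2 : 0 ≤ δ / 2 ^ n * ‖x‖ := by positivity
    have h3 : δ / 2 ^ (n + 1) * ‖x‖ = δ / 2 ^ n * ‖x‖ / 2 := by rw [pow_succ]; ring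
    have h4 : 4 * δ * ‖x‖ / 2 / 2 ^ n = 2 * (δ / 2 ^ n * ‖x‖) := by ring
    linarith
  choose! next hnext hclose using step
  obtain ⟨ψ₀, hψ₀⟩ := h φ r hp hq δ hδ0
  let Ψ : ℕ → ((Fin m → ℝ) →ₗ[ℝ] G) := fun n => Nat.rec ψ₀ next n
  have hgood : ∀ n, Good n (Ψ n) := fun n => by
    induction n with
    | zero => exact fun x => by simpa using! ⟨(hψ₀ x).1, (hψ₀ x).2.1⟩
    | succ n ih => exact hnext n _ ih
  have hdist : ∀ x n, dist (Ψ n x) (Ψ (n + 1) x) ≤ 4 * δ * ‖x‖ / 2 / 2 ^ n := fun x n => by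
    rw [dist_eq_norm]
    exact hclose n _ (hgood n) x
  choose L hL using fun x => cauchySeq_tendsto_of_complete (cauchySeq_of_le_geometric_two (hdist x))
  let ψ : (Fin m → ℝ) →ₗ[ℝ] G := linearMapOfTendsto L Ψ (tendsto_pi_nhds.2 hL)
  have hzero : ∀ x : Fin m → ℝ, Filter.Tendsto (fun n : ℕ => δ / 2 ^ n * ‖x‖) Filter.atTop
      (nhds 0) := fun x => by
    have h1 := ((tendsto_pow_atTop_nhds_zero_of_lt_one (r := (1 / 2 : ℝ)) (by norm_num)
      (by norm_num)).const_mul δ).mul_const ‖x‖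
    rw [mul_zero, zero_mul] at h1
    refine h1.congr fun n => ?_
    rw [one_div, inv_pow, div_eq_mul_inv]
  have hlim : ∀ (f : ℕ → ℝ) (a b : ℝ) (x : Fin m → ℝ), Filter.Tendsto f Filter.atTop (nhds a) →
      (∀ n, |f n - b| ≤ δ / 2 ^ n * ‖x‖) → a = b := fun f a b x hf hb => by
    refine tendsto_nhds_unique hf ?_
    rw [tendsto_iff_norm_sub_tendsto_zero]
    exact squeeze_zero (fun n => norm_nonneg _) hb (hzero x)
  refine ⟨ψ, fun x => ⟨?_, ?_, ?_⟩⟩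
  · exact hlim _ _ _ x (hL x).norm fun n => (hgood n x).1
  · have hSc := seminorm_continuous_of_le_norm S (C := 1) (by simpa using hS)
    exact hlim _ _ _ x ((hSc.tendsto _).comp (hL x)) fun n => (hgood n x).2
  · have h1 := dist_le_of_le_geometric_two_of_tendsto₀ (hdist x) (hL x)
    rw [dist_eq_norm] at h1
    have h2 := (hψ₀ x).2.2
    have h3 := norm_sub_le_norm_sub_add_norm_sub (φ x) (ψ₀ x) (ψ x)
    have h4 : 0 ≤ δ * ‖x‖ := by positivity
    have h5 : ε * ‖x‖ = 8 * (δ * ‖x‖) := by rw [hδ]; ring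
    change ‖ψ₀ x - ψ x‖ ≤ _ at h1
    linarith

/-! ### Linear algebra of seminorms -/

theorem exists_seminorm_le_mul_of_definite {V : Type*} [AddCommGroup V] [Module ℝ V]
    [FiniteDimensional ℝ V] (P q : Seminorm ℝ V) (hP : ∀ v, P v = 0 → v = 0) :
    ∃ C : ℝ, 0 < C ∧ ∀ v, q v ≤ C * P v := by
  let : Norm V := ⟨P⟩
  have core : NormedSpace.Core ℝ V :=
    { norm_nonneg := apply_nonneg P
      norm_smul := map_smul_eq_mul P
      norm_triangle := map_add_le_add P
      norm_eq_zero_iff := fun w => ⟨hP w, fun h => h ▸ map_zero P⟩ }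
  let : NormedAddCommGroup V := NormedAddCommGroup.ofCore core
  let : NormedSpace ℝ V := NormedSpace.ofCore core
  let e := (Module.finBasis ℝ V).equivFun
  obtain ⟨C, hC, hCq⟩ := exists_seminorm_le_mul_norm (q.comp e.symm.toLinearMap)
  obtain ⟨C', hC', hCe⟩ := (LinearMap.toContinuousLinearMap e.toLinearMap).bound
  refine ⟨C * C', by positivity, fun v => ?_⟩
  have h1 := hCq (e v)
  have h2 : ‖e v‖ ≤ C' * P v := hCe v
  rw [Seminorm.comp_apply, LinearEquiv.coe_coe, e.symm_apply_apply] at h1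
  calc q v ≤ C * ‖e v‖ := h1
    _ ≤ C * (C' * P v) := by gcongr
    _ = C * C' * P v := by ring

/-- The null space of a seminorm. -/
def nullSpace {V : Type*} [AddCommGroup V] [Module ℝ V] (q : Seminorm ℝ V) : Submodule ℝ V where
  carrier := {x | q x = 0}
  zero_mem' := map_zero q
  add_mem' {a b} (ha : q a = 0) (hb : q b = 0) := le_antisymm
    ((map_add_le_add q a b).trans (by rw [ha, hb, add_zero])) (apply_nonneg q _)
  smul_mem' c x (hx : q x = 0) := by
    change q (c • x) = 0
    rw [map_smul_eq_mul, hx, mul_zero]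

theorem exists_linearMap_of_null {V : Type*} [AddCommGroup V] [Module ℝ V] (q : Seminorm ℝ V) :
    ∃ ρ : V →ₗ[ℝ] V, (∀ x, q x = 0 → ρ x = 0) ∧ ∀ x, q (x - ρ x) = 0 := by
  obtain ⟨D, hD⟩ := (nullSpace q).exists_isCompl
  refine ⟨D.subtype ∘ₗ D.projectionOnto (nullSpace q) hD.symm, fun x hx => ?_, fun x => ?_⟩
  · rw [LinearMap.comp_apply, (Submodule.projectionOnto_apply_eq_zero_iff hD.symm).2 hx,
      map_zero]
  · have h : x - D.projectionOnto (nullSpace q) hD.symm x ∈ nullSpace q := by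
      rw [← Submodule.projectionOnto_apply_eq_zero_iff hD.symm, map_sub,
        Submodule.projectionOnto_apply_left, sub_self]
    exact h

theorem exists_seminorm_le_mul_of_null {V : Type*} [AddCommGroup V] [Module ℝ V]
    [FiniteDimensional ℝ V] (p q : Seminorm ℝ V) (h : ∀ v, p v = 0 → q v = 0) :
    ∃ C : ℝ, 0 < C ∧ ∀ v, q v ≤ C * p v := by
  obtain ⟨ρ, hρ0, hρ⟩ := exists_linearMap_of_null p
  have hle : ∀ (s : Seminorm ℝ V) x, s (x - ρ x) = 0 → s x = s (ρ x) := fun s x hx => by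
    have h1 := abs_seminorm_sub_le s x (ρ x)
    rw [hx] at h1
    exact sub_eq_zero.1 (abs_nonpos_iff.1 h1)
  obtain ⟨C, hC, hCq⟩ := exists_seminorm_le_mul_of_definite
    (p.comp (LinearMap.range ρ).subtype) (q.comp (LinearMap.range ρ).subtype) (by
      rintro ⟨_, x, rfl⟩ hx
      exact Subtype.ext (hρ0 x ((hle p x (hρ x)).trans hx)))
  refine ⟨C, hC, fun v => ?_⟩
  rw [hle p v (hρ v), hle q v (h _ (hρ v))]
  exact hCq ⟨ρ v, v, rfl⟩

/-- Project along a complement of `E` that contains a complement of `E ⊓ nullSpace q` within the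
null space. Null vectors then project to null vectors. -/
theorem exists_retraction {V : Type*} [AddCommGroup V] [Module ℝ V] (E : Submodule ℝ V)
    (q : Seminorm ℝ V) : ∃ π : V →ₗ[ℝ] E, (∀ x : E, π x = x) ∧ ∀ x, q x = 0 → q (π x) = 0 := by
  obtain ⟨D, hD⟩ := (E ⊓ nullSpace q).exists_isCompl
  have hdisj : Disjoint E (D ⊓ nullSpace q) := by
    rw [disjoint_iff, inf_comm D, ← inf_assoc]
    exact hD.inf_eq_bot
  obtain ⟨C, hC, hEC⟩ := hdisj.symm.exists_isCompl
  replace hEC := hEC.symm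
  refine ⟨E.projectionOnto C hEC, Submodule.projectionOnto_apply_left hEC,
    fun x hx => ?_⟩
  obtain ⟨a, ha, b, hb, rfl⟩ := Submodule.mem_sup.1
    (hD.sup_eq_top ▸ Submodule.mem_top : x ∈ (E ⊓ nullSpace q) ⊔ D)
  have hbn : b ∈ nullSpace q := by
    have := (nullSpace q).sub_mem (show a + b ∈ nullSpace q from hx) ha.2
    rwa [add_sub_cancel_left] at this
  rw [map_add, (Submodule.projectionOnto_apply_eq_zero_iff hEC).2 (hC ⟨hb, hbn⟩), add_zero,
    show E.projectionOnto C hEC a = ⟨a, ha.1⟩ from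
      Submodule.projectionOnto_apply_left hEC ⟨a, ha.1⟩]
  exact ha.2

/-! ### Homogeneity -/

/-- Exact correction of `φ ∘ π` yields `ψ₁`, which preserves norm and seminorm and is close to `φ`
on `E`; the map is then `ψ₁ + Δ ∘ π` with `Δ = φ - ψ₁` on `E`. The seminorm error must be small
relative to `SF x`, even when that is far below `‖x‖`, which is why `π` and `ρ` must respect null
vectors. -/
theorem exists_epsMorphism {G : Type u} [NormedAddCommGroup G] [NormedSpace ℝ G] [CompleteSpace G]
    {S : Seminorm ℝ G} (hS : ∀ x, S x ≤ ‖x‖) {F : Type w} [NormedAddCommGroup F] [NormedSpace ℝ F]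
    [FiniteDimensional ℝ F] (E : Submodule ℝ F) (SF : Seminorm ℝ F) (hSF : ∀ x, SF x ≤ ‖x‖)
    (hcor : ∀ (m : ℕ) (e : (Fin m → ℝ) ≃ₗ[ℝ] F),
      Corrects S ((normSeminorm ℝ F).comp e.toLinearMap) (SF.comp e.toLinearMap))
    {ε : ℝ} (hε : 0 < ε) (φ : E →ₗ[ℝ] G) (hφ : ∀ x, ‖φ x‖ = ‖x‖) (hφS : ∀ x, S (φ x) = SF x) :
    ∃ ψ : F →ₗ[ℝ] G, (∀ x : E, ψ (x : F) = φ x) ∧ IsEpsMorphism ε SF S ψ := by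
  obtain ⟨π, hπ, hπ0⟩ := exists_retraction E SF
  obtain ⟨ρ, hρ0, hρ⟩ := exists_linearMap_of_null (SF.comp E.subtype)
  let e : (Fin (Module.finrank ℝ F) → ℝ) ≃ₗ[ℝ] F := (Module.finBasis ℝ F).equivFun.symm
  obtain ⟨C₀, hC₀, he⟩ := (LinearMap.toContinuousLinearMap e.symm.toLinearMap).bound
  obtain ⟨C₁, hC₁, hπC⟩ := (LinearMap.toContinuousLinearMap π).bound
  -- `ρ ∘ π` kills the null vectors of `SF`, so in finite dimension its norm is controlled by `SF`.
  obtain ⟨C₂, hC₂, hρC⟩ := exists_seminorm_le_mul_of_null SF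
    ((normSeminorm ℝ E).comp (ρ ∘ₗ π)) fun v hv => by
      have : ρ (π v) = 0 := hρ0 _ (hπ0 v hv)
      simp [this]
  set δ := ε / (C₀ * (C₁ + C₂)) with hδ
  have hδ0 : 0 < δ := by positivity
  have hδε : δ * C₀ * (C₁ + C₂) = ε := by
    rw [hδ, mul_assoc]
    exact div_mul_cancel₀ _ (by positivity)
  let κ : F →ₗ[ℝ] F := LinearMap.id - E.subtype ∘ₗ π
  obtain ⟨ψ₀, hψ₀⟩ := (hcor _ e).exists_exact hS (φ ∘ₗ π ∘ₗ e.toLinearMap)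
    ((normSeminorm ℝ F).comp (κ ∘ₗ e.toLinearMap))
    (fun x => by
      change |‖φ (π (e x))‖ - ‖e x‖| ≤ ‖e x - π (e x)‖
      rw [hφ, abs_sub_comm]
      exact abs_norm_sub_norm_le (e x) (π (e x) : F))
    (fun x => by
      change |S (φ (π (e x))) - SF (e x)| ≤ ‖e x - π (e x)‖
      rw [hφS, abs_sub_comm]
      exact (abs_seminorm_sub_le SF _ _).trans (hSF _)) hδ0
  let ψ₁ : F →ₗ[ℝ] G := ψ₀ ∘ₗ e.symm.toLinearMap
  have hψ₁ : ∀ y, ‖ψ₁ y‖ = ‖y‖ := fun y => by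
    have := (hψ₀ (e.symm y)).1
    simpa using! this
  have hψ₁S : ∀ y, S (ψ₁ y) = SF y := fun y => by
    have := (hψ₀ (e.symm y)).2.1
    simpa using! this
  let Δ : E →ₗ[ℝ] G := φ - ψ₁ ∘ₗ E.subtype
  have hΔ : ∀ y : E, ‖Δ y‖ ≤ δ * C₀ * ‖y‖ := fun y => by
    have h1 := (hψ₀ (e.symm y)).2.2
    have h2 : ‖e.symm (y : F)‖ ≤ C₀ * ‖y‖ := he y
    have h3 : κ (y : F) = 0 := by simp [κ, hπ]
    have h4 : ‖φ (π (e (e.symm (y : F)))) - ψ₁ y‖ ≤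
        ‖κ (e (e.symm (y : F)))‖ + δ * ‖e.symm (y : F)‖ := h1
    rw [e.apply_symm_apply, h3, norm_zero, zero_add, hπ] at h4
    calc ‖Δ y‖ ≤ δ * ‖e.symm (y : F)‖ := h4
      _ ≤ δ * (C₀ * ‖y‖) := by gcongr
      _ = _ := by ring
  refine ⟨ψ₁ + Δ ∘ₗ π, fun x => ?_, fun x => ?_, fun x => ?_⟩
  · simp [Δ, hπ]
  · have h1 : ‖Δ (π x)‖ ≤ ε * ‖x‖ := by
      have h2 : ‖π x‖ ≤ C₁ * ‖x‖ := hπC x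
      calc ‖Δ (π x)‖ ≤ δ * C₀ * ‖π x‖ := hΔ _
        _ ≤ δ * C₀ * (C₁ * ‖x‖) := by gcongr
        _ ≤ δ * C₀ * ((C₁ + C₂) * ‖x‖) := by gcongr; linarith
        _ = ε * ‖x‖ := by rw [← hδε]; ring
    have h2 := abs_le.1 (abs_norm_sub_norm_le (ψ₁ x + Δ (π x)) (ψ₁ x))
    rw [add_sub_cancel_left, hψ₁] at h2
    change _ ≤ ‖ψ₁ x + Δ (π x)‖ ∧ ‖ψ₁ x + Δ (π x)‖ ≤ _
    constructor <;> linarith [h2.1, h2.2]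
  -- On null vectors of `E` both `φ` and `ψ₁` land in the kernel of `S`, so `Δ` does too, and only
  -- `ρ (π x)` contributes to `S (Δ (π x))`.
  · have h0 : S (Δ (π x - ρ (π x))) = 0 := by
      set k := π x - ρ (π x) with hk
      have h1 : SF (k : F) = 0 := hρ (π x)
      have h2 := map_sub_le_add S (φ k) (ψ₁ k)
      rw [hφS, hψ₁S, h1, add_zero] at h2
      exact le_antisymm h2 (apply_nonneg S _)
    have h1 : S (Δ (π x)) ≤ ε * SF x := by
      have h2 : ‖ρ (π x)‖ ≤ C₂ * SF x := hρC x
      have h3 := map_add_le_add S (Δ (π x - ρ (π x))) (Δ (ρ (π x)))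
      rw [← map_add, sub_add_cancel, h0, zero_add] at h3
      have h4 := apply_nonneg SF x
      calc S (Δ (π x)) ≤ ‖Δ (ρ (π x))‖ := h3.trans (hS _)
        _ ≤ δ * C₀ * ‖ρ (π x)‖ := hΔ _
        _ ≤ δ * C₀ * (C₂ * SF x) := by gcongr
        _ ≤ δ * C₀ * ((C₁ + C₂) * SF x) := by gcongr; linarith
        _ = ε * SF x := by rw [← hδε]; ring
    have h2 := abs_seminorm_sub_le S (ψ₁ x + Δ (π x)) (ψ₁ x)
    rw [add_sub_cancel_left, hψ₁S, abs_sub_comm] at h2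
    exact h2.trans h1

theorem exists_isGurarij :
    ∃ (G : Type) (_ : NormedAddCommGroup G) (_ : NormedSpace ℝ G), IsGurarij G := by
  obtain ⟨G, i1, i2, hc, hs, hcor⟩ := exists_corrects_zero
  refine ⟨G, i1, i2, hc, hs, fun F _ _ _ E φ ε hε => ?_⟩
  obtain ⟨ψ, hψ, hψε⟩ := exists_epsMorphism (S := (0 : Seminorm ℝ G)) (fun x => norm_nonneg x) E 0
    (fun x => norm_nonneg x) (fun m e => by simpa using hcor m _) hε φ.toLinearMap φ.norm_map
    fun x => rfl
  exact ⟨ψ, hψ, hψε.1⟩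

theorem isHomogeneous_of_corrects {G : Type u} [NormedAddCommGroup G] [NormedSpace ℝ G]
    [CompleteSpace G] {S : Seminorm ℝ G} (hS : ∀ x, S x ≤ ‖x‖)
    (hcor : ∀ (m : ℕ) (p q : Seminorm ℝ (Fin m → ℝ)), (∀ x, q x ≤ p x) → Corrects S p q) :
    IsHomogeneous.{u, w} S := by
  intro F _ _ _ E SE SF _ hSF hext ε hε φ hφ
  have hSF' := le_norm_of_lipschitzWith_one SF hSF
  refine exists_epsMorphism hS E SF hSF' (fun m e => hcor m _ _ fun x => hSF' (e x)) hε φ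
    (fun x => ?_) fun x => ?_
  · have := hφ.1 x
    simp only [sub_zero, add_zero, one_mul] at this
    exact le_antisymm this.2 this.1
  · have := hφ.2 x
    rw [zero_mul, abs_nonpos_iff, sub_eq_zero] at this
    rw [hext, this]

/-! ### Universality -/

/-- A tuple as a finitely supported sequence. -/
noncomputable def tupleToFinsupp (n : ℕ) : (Fin n → ℝ) →ₗ[ℝ] (ℕ →₀ ℝ) :=
  Fintype.linearCombination ℝ fun i : Fin n => Finsupp.single (i : ℕ) 1

/-- The first `n` terms of a finitely supported sequence. -/
noncomputable def finsuppToTuple (n : ℕ) : (ℕ →₀ ℝ) →ₗ[ℝ] (Fin n → ℝ) :=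
  LinearMap.pi fun i => Finsupp.lapply (i : ℕ)

theorem tupleToFinsupp_finsuppToTuple {n : ℕ} {v : ℕ →₀ ℝ} (hv : v.support ⊆ Finset.range n) :
    tupleToFinsupp n (finsuppToTuple n v) = v := by
  have h1 := Fin.sum_univ_eq_sum_range (fun i => v i • Finsupp.single i (1 : ℝ)) n
  have h2 := Finsupp.sum_of_support_subset v hv (fun i a => a • Finsupp.single i (1 : ℝ))
    (fun i _ => zero_smul _ _)
  rw [← h2] at h1
  refine h1.trans ?_
  simp only [Finsupp.smul_single, smul_eq_mul, mul_one]
  exact Finsupp.sum_single v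

theorem support_tupleToFinsupp_subset {n : ℕ} (c : Fin n → ℝ) :
    (tupleToFinsupp n c).support ⊆ Finset.range n := by
  classical
  refine Finsupp.support_finsetSum.trans (Finset.biUnion_subset.2 fun i _ => ?_)
  refine Finsupp.support_smul.trans (Finsupp.support_single_subset.trans ?_)
  simp

theorem norm_finsuppToTuple_le (n : ℕ) (v : ℕ →₀ ℝ) :
    ‖finsuppToTuple n v‖ ≤ ∑ i ∈ v.support, |v i| := by
  refine (pi_norm_le_iff_of_nonneg (Finset.sum_nonneg fun i _ => abs_nonneg _)).2 fun i => ?_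
  change |v i| ≤ _
  by_cases hi : (i : ℕ) ∈ v.support
  · exact Finset.single_le_sum (f := fun i => |v i|) (fun i _ => abs_nonneg _) hi
  · rw [Finsupp.notMem_support_iff.1 hi, abs_zero]
    exact Finset.sum_nonneg fun i _ => abs_nonneg _

/-- Coordinates are added one at a time. Truncating the new coordinate has defect `p (tr v - v)`,
which vanishes on the old vectors, so correction moves those by at most `(1 / 2) ^ n` times their
size and the maps converge pointwise. -/
theorem exists_isometry_finsupp {G : Type*} [NormedAddCommGroup G] [NormedSpace ℝ G]
    [CompleteSpace G] {S : Seminorm ℝ G} (hS : ∀ x, S x ≤ ‖x‖)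
    (hcor : ∀ (m : ℕ) (p q : Seminorm ℝ (Fin m → ℝ)), (∀ x, q x ≤ p x) → Corrects S p q)
    (p q : Seminorm ℝ (ℕ →₀ ℝ)) (hqp : ∀ v, q v ≤ p v) :
    ∃ ψ : (ℕ →₀ ℝ) →ₗ[ℝ] G, ∀ v, ‖ψ v‖ = p v ∧ S (ψ v) = q v := by
  let Good : ℕ → ((ℕ →₀ ℝ) →ₗ[ℝ] G) → Prop := fun n ψ =>
    ∀ v, v.support ⊆ Finset.range n → ‖ψ v‖ = p v ∧ S (ψ v) = q v
  have step : ∀ n ψ, Good n ψ → ∃ ψ', Good (n + 1) ψ' ∧ ∀ v : ℕ →₀ ℝ,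
      v.support ⊆ Finset.range n → ‖ψ v - ψ' v‖ ≤ (1 / 2) ^ n * ∑ i ∈ v.support, |v i| := by
    intro n ψ hψ
    set J := tupleToFinsupp (n + 1) with hJ
    let tr : (ℕ →₀ ℝ) →ₗ[ℝ] (ℕ →₀ ℝ) := tupleToFinsupp n ∘ₗ finsuppToTuple n
    have htr : ∀ v, (tr v).support ⊆ Finset.range n := fun v => support_tupleToFinsupp_subset _
    obtain ⟨ψ', hψ'⟩ := (hcor (n + 1) (p.comp J) (q.comp J) fun x => hqp _).exists_exact hS
      (ψ ∘ₗ tr ∘ₗ J) (p.comp (tr ∘ₗ J - J))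
      (fun x => by
        change |‖ψ (tr (J x))‖ - p (J x)| ≤ p (tr (J x) - J x)
        rw [(hψ _ (htr _)).1]
        exact abs_seminorm_sub_le p _ _)
      (fun x => by
        change |S (ψ (tr (J x))) - q (J x)| ≤ p (tr (J x) - J x)
        rw [(hψ _ (htr _)).2]
        exact (abs_seminorm_sub_le q _ _).trans (hqp _)) (ε := (1 / 2) ^ n) (by positivity)
    refine ⟨ψ' ∘ₗ finsuppToTuple (n + 1), fun v hv => ?_, fun v hv => ?_⟩
    · obtain ⟨h1, h2, -⟩ := hψ' (finsuppToTuple (n + 1) v)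
      rw [Seminorm.comp_apply, hJ, tupleToFinsupp_finsuppToTuple hv] at h1 h2
      exact ⟨h1, h2⟩
    · obtain ⟨-, -, h3⟩ := hψ' (finsuppToTuple (n + 1) v)
      have hv' : v.support ⊆ Finset.range (n + 1) :=
        hv.trans (Finset.range_subset_range.2 n.le_succ)
      have htv : tr v = v := tupleToFinsupp_finsuppToTuple hv
      have hJv : J (finsuppToTuple (n + 1) v) = v := tupleToFinsupp_finsuppToTuple hv'
      simp only [LinearMap.comp_apply, Seminorm.comp_apply, LinearMap.sub_apply, hJv, htv,
        sub_self, map_zero, zero_add] at h3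
      refine h3.trans ?_
      gcongr
      exact norm_finsuppToTuple_le _ _
  choose! next hnext hclose using step
  -- The zero map is a valid start: `Good 0` concerns the zero vector only.
  let Ψ : ℕ → ((ℕ →₀ ℝ) →ₗ[ℝ] G) := fun n => Nat.rec 0 next n
  have hgood : ∀ n, Good n (Ψ n) := fun n => by
    induction n with
    | zero =>
      intro v hv
      have : v = 0 := by simpa using hv
      subst this
      simp
    | succ n ih => exact hnext n _ ih
  have hsupp : ∀ v : ℕ →₀ ℝ, ∃ N, v.support ⊆ Finset.range N := fun v =>
    Finset.exists_nat_subset_range _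
  have hmono : ∀ {v : ℕ →₀ ℝ} {N : ℕ}, v.support ⊆ Finset.range N → ∀ k,
      v.support ⊆ Finset.range (k + N) := fun h k =>
    h.trans (Finset.range_subset_range.2 (Nat.le_add_left _ _))
  have hconv : ∀ v, ∃ L, Filter.Tendsto (fun n => Ψ n v) Filter.atTop (nhds L) := fun v => by
    obtain ⟨N, hN⟩ := hsupp v
    have h1 : CauchySeq fun k => Ψ (k + N) v := by
      refine cauchySeq_of_le_geometric (1 / 2) (∑ i ∈ v.support, |v i|) (by norm_num) fun k => ?_
      rw [dist_eq_norm, add_right_comm]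
      refine (hclose (k + N) _ (hgood _) v (hmono hN k)).trans ?_
      rw [mul_comm]
      refine mul_le_mul_of_nonneg_left ?_ (Finset.sum_nonneg fun i _ => abs_nonneg _)
      exact pow_le_pow_of_le_one (by norm_num) (by norm_num) (Nat.le_add_right _ _)
    obtain ⟨L, hL⟩ := cauchySeq_tendsto_of_complete h1
    exact ⟨L, (Filter.tendsto_add_atTop_iff_nat N).1 hL⟩
  choose L hL using hconv
  have hev : ∀ v, ∀ᶠ n in Filter.atTop, ‖Ψ n v‖ = p v ∧ S (Ψ n v) = q v := fun v => by
    obtain ⟨N, hN⟩ := hsupp v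
    filter_upwards [Filter.eventually_ge_atTop N] with n hn
    exact hgood n v (hN.trans (Finset.range_subset_range.2 hn))
  have hSc := seminorm_continuous_of_le_norm S (C := 1) (by simpa using hS)
  refine ⟨linearMapOfTendsto L Ψ (tendsto_pi_nhds.2 hL), fun v => ⟨?_, ?_⟩⟩
  · exact tendsto_nhds_unique_of_eventuallyEq (hL v).norm tendsto_const_nhds
      ((hev v).mono fun n h => h.1)
  · exact tendsto_nhds_unique_of_eventuallyEq ((hSc.tendsto _).comp (hL v)) tendsto_const_nhds
      ((hev v).mono fun n h => h.2)

theorem exists_linearIsometry_preserving {G : Type*} [NormedAddCommGroup G] [NormedSpace ℝ G]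
    [CompleteSpace G] {S : Seminorm ℝ G} (hS : ∀ x, S x ≤ ‖x‖)
    (hcor : ∀ (m : ℕ) (p q : Seminorm ℝ (Fin m → ℝ)), (∀ x, q x ≤ p x) → Corrects S p q)
    {X : Type*} [NormedAddCommGroup X] [NormedSpace ℝ X] [TopologicalSpace.SeparableSpace X]
    (T : Seminorm ℝ X) (hT : ∀ x, T x ≤ ‖x‖) :
    ∃ φ : X →ₗᵢ[ℝ] G, ∀ x, S (φ x) = T x := by
  let e : (ℕ →₀ ℝ) →ₗ[ℝ] X := Finsupp.linearCombination ℝ (TopologicalSpace.denseSeq X)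
  have he : DenseRange e := by
    refine (TopologicalSpace.denseRange_denseSeq X).mono ?_
    rintro _ ⟨i, rfl⟩
    exact ⟨Finsupp.single i 1, by simp [e]⟩
  obtain ⟨ψ, hψ⟩ := exists_isometry_finsupp hS hcor ((normSeminorm ℝ X).comp e) (T.comp e)
    fun v => hT _
  have hψe : ∀ v, ψ.extendOfNorm e (e v) = ψ v :=
    LinearMap.extendOfNorm_eq he ⟨1, fun v => by rw [one_mul]; exact (hψ v).1.le⟩
  have hSc := seminorm_continuous_of_le_norm S (C := 1) (by simpa using hS)
  have hTc := seminorm_continuous_of_le_norm T (C := 1) (by simpa using hT)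
  have hcont := (ψ.extendOfNorm e).continuous
  refine ⟨⟨(ψ.extendOfNorm e).toLinearMap, fun x => ?_⟩, fun x => ?_⟩
  · refine he.induction_on (p := fun x => ‖ψ.extendOfNorm e x‖ = ‖x‖) x
      (isClosed_eq hcont.norm continuous_norm) fun v => ?_
    rw [hψe]
    exact (hψ v).1
  · refine he.induction_on (p := fun x => S (ψ.extendOfNorm e x) = T x) x
      (isClosed_eq (hSc.comp hcont) hTc) fun v => ?_
    rw [hψe]
    exact (hψ v).2

/-- Embed `X` so that `S` pulls back to `T = dist(·, Y)`. Then `φ` maps `Y` into the kernel, so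
distances do not grow; and `S` is `1`-Lipschitz and vanishes on the kernel, so `dist(φ x, H) ≥ S (φ
x) = dist(x, Y)`. -/
theorem isUniversalClosedSubspace_kernel {G : Type u} [NormedAddCommGroup G] [NormedSpace ℝ G]
    [CompleteSpace G] {S : Seminorm ℝ G} (hS : ∀ x, S x ≤ ‖x‖)
    (hcor : ∀ (m : ℕ) (p q : Seminorm ℝ (Fin m → ℝ)), (∀ x, q x ≤ p x) → Corrects S p q) :
    IsUniversalClosedSubspace.{u, v} (kernel S) := by
  have hSc := seminorm_continuous_of_le_norm S (C := 1) (by simpa using hS)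
  refine ⟨isClosed_singleton.preimage hSc, fun X _ _ _ _ Y _ => ?_⟩
  let T : Seminorm ℝ X := infConv (normSeminorm ℝ X) (0 : Seminorm ℝ Y) Y.subtype
  obtain ⟨φ, hφ⟩ := exists_linearIsometry_preserving hS hcor T (infConv_le_left _ _ _)
  have hTY : ∀ y : Y, T y = 0 := fun y =>
    le_antisymm (infConv_apply_le (normSeminorm ℝ X) (0 : Seminorm ℝ Y) Y.subtype y)
      (apply_nonneg T _)
  refine ⟨φ, fun x => ?_⟩
  have h1 : Metric.infDist x (Y : Set X) ≤ T x := le_infConv _ _ _ fun y => by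
    refine (Metric.infDist_le_dist_of_mem y.2).trans (le_of_eq ?_)
    rw [dist_eq_norm]
    simp
  have hY : (Y : Set X).Nonempty := ⟨0, Y.zero_mem⟩
  have hH : (kernel S : Set G).Nonempty := ⟨0, (kernel S).zero_mem⟩
  refine le_antisymm (h1.trans ((Metric.le_infDist hH).2 fun h hh => ?_))
    ((Metric.le_infDist hY).2 fun y hy => ?_)
  · have h2 : S h = 0 := hh
    have h3 := map_add_le_add S (φ x - h) h
    rw [sub_add_cancel, h2, add_zero, hφ] at h3
    rw [dist_eq_norm]
    exact h3.trans (hS _)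
  · have h2 : φ y ∈ (kernel S : Set G) := (hφ y).trans (hTY ⟨y, hy⟩)
    rw [← φ.dist_map]
    exact Metric.infDist_le_dist_of_mem h2

end GurarijSeminorm

theorem mainTheorem7 :
    (∃ (G : Type) (_ : NormedAddCommGroup G) (_ : NormedSpace ℝ G),
      GurarijSeminorm.IsGurarij G) ∧
    ∀ (G : Type u) [NormedAddCommGroup G] [NormedSpace ℝ G], GurarijSeminorm.IsGurarij G →
      ∃ S : Seminorm ℝ G, LipschitzWith 1 S ∧
        GurarijSeminorm.IsHomogeneous.{u, w} S ∧
        GurarijSeminorm.IsUniversalClosedSubspace.{u, v} (GurarijSeminorm.kernel S) := by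
  refine ⟨GurarijSeminorm.exists_isGurarij, fun G _ _ hG => ?_⟩
  have := hG.complete
  obtain ⟨S, hS, hcor⟩ := hG.exists_seminorm_corrects
  exact ⟨S, GurarijSeminorm.lipschitzWith_one_of_le S hS,
    GurarijSeminorm.isHomogeneous_of_corrects hS hcor,
    GurarijSeminorm.isUniversalClosedSubspace_kernel hS hcor⟩
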